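/- **Processes.** Channels are $\mathsf c\in\{\mathsf l,\mathsf r\}$ with $\overline{\mathsf l}=\mathsf r$, $\overline{\mathsf r}=\mathsf l$; selectors are $\ell\in\{\mathsf{inl},\mathsf{inr}\}$. Basic types include $\mathsf{unit}$, $\mathsf{bool}$, $\mathsf{int}$, basic values include $()$, $\mathsf{true}$, $\mathsf{false}$ and the integers; $v\in t$ means that $v$ has type $t$. Expressions are $e::=x\mid v\mid e_1=e_2$, with the evident deterministic evaluation $e\downarrow v$ (a variable has no value). Processes are $$P::=\mathbf 0\mid \mathsf c?(x{:}t).P\mid \mathsf c!e.P\mid \mathsf c\triangleleft\ell.P\mid \mathsf c\triangleright\{P,Q\}\mid \mathrm{if}\ e\ \mathrm{then}\ P\ \mathrm{else}\ Q\mid P\,\|\,Q,$$ taken up to renaming of bound variables. Structural congruence $\equiv$ is the least congruence with $\mathbf 0\|\mathbf 0\equiv\mathbf 0$ and $P\|(Q\|R)\equiv(P\|Q)\|R$ (composition is not commutative). Reduction $\to$ is the least relation, closed under $\equiv$ and under reduction contexts $\mathcal C::=[\,]\mid\mathcal C\|P\mid P\|\mathcal C$, such that, for $e\downarrow v\in t$,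 $\mathsf r!e.P\,\|\,\mathsf l?(x{:}t).Q\to P\,\|\,Q\{v/x\}$ and $\mathsf r?(x{:}t).P\,\|\,\mathsf l!e.Q\to P\{v/x\}\,\|\,Q$; moreover $\mathsf r\triangleleft\ell.P\,\|\,\mathsf l\triangleright\{Q_{\mathsf{inl}},Q_{\mathsf{inr}}\}\to P\|Q_\ell$ and $\mathsf r\triangleright\{P_{\mathsf{inl}},P_{\mathsf{inr}}\}\,\|\,\mathsf l\triangleleft\ell.Q\to P_\ell\|Q$; and $\mathrm{if}\ e\ \mathrm{then}\ P_{\mathsf{true}}\ \mathrm{else}\ P_{\mathsf{false}}\to P_v$ if $e\downarrow v\in\mathsf{bool}$. A process $P$ is *correct* if $P\to^*Q\not\to$ implies $Q\equiv\mathbf 0$. We write $P\approx Q$ if for every reduction context $\mathcal C$, $\mathcal C[P]$ is correct if and only if $\mathcal C[Q]$ is correct. **Types.** Session types are $T::=\mathsf{end}\mid\,?t.T\mid\,!t.T\mid T+S\mid T\oplus S$; the dual $\overline T$ exchanges $?$ with $!$ and $+$ with $\oplus$. An environment $\Gamma$ maps finitely many variables to basic types; expressions are typed by $\Gamma,x{:}t\vdash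 x:t$; $\Gamma\vdash v:t$ if $v\in t$; $\Gamma\vdash (e_1=e_2):\mathsf{bool}$ if $e_1,e_2$ have a common type. A process is typed by $\Gamma\vdash P\triangleright\{\mathsf c:T,\overline{\mathsf c}:S\}$, according to the rules: $\mathbf 0$ has type $\mathsf{end}$ on both channels; $\mathsf c?(x{:}t).P$ has $\{\mathsf c:?t.T,\overline{\mathsf c}:S\}$ in $\Gamma$ if $P$ has $\{\mathsf c:T,\overline{\mathsf c}:S\}$ in $\Gamma,x{:}t$; $\mathsf c!e.P$ has $\{\mathsf c:!t.T,\overline{\mathsf c}:S\}$ if $\Gamma\vdash e:t$ and $P$ has $\{\mathsf c:T,\overline{\mathsf c}:S\}$; $\mathsf c\triangleright\{P_1,P_2\}$ has $\{\mathsf c:T_1+T_2,\overline{\mathsf c}:S\}$ if each $P_i$ has $\{\mathsf c:T_i,\overline{\mathsf c}:S\}$; $\mathsf c\triangleleft\mathsf{inl}.P$ (resp. $\mathsf c\triangleleft\mathsf{inr}.P$) has $\{\mathsf c:T_1\oplus T_2,\overline{\mathsf c}:S\}$ if $P$ has $\{\mathsf c:T_1,\overline{\mathsf c}:S\}$ (resp.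 $\{\mathsf c:T_2,\overline{\mathsf c}:S\}$); a conditional has the common type of its branches if its condition has type $\mathsf{bool}$; $P\|Q$ has $\{\mathsf l:T,\mathsf r:S\}$ if, for some $T'$, $P$ has $\{\mathsf l:T,\mathsf r:T'\}$ and $Q$ has $\{\mathsf l:\overline{T'},\mathsf r:S\}$. The identity process of a type is given by $\mathrm{id}_{\mathsf{end}}=\mathbf 0$, $\mathrm{id}_{!t.T}=\mathsf l?(x{:}t).\mathsf r!x.\mathrm{id}_T$, $\mathrm{id}_{?t.T}=\mathsf r?(x{:}t).\mathsf l!x.\mathrm{id}_T$, $\mathrm{id}_{T\oplus S}=\mathsf l\triangleright\{\mathsf r\triangleleft\mathsf{inl}.\mathrm{id}_T,\ \mathsf r\triangleleft\mathsf{inr}.\mathrm{id}_S\}$, $\mathrm{id}_{T+S}=\mathsf r\triangleright\{\mathsf l\triangleleft\mathsf{inl}.\mathrm{id}_T,\ \mathsf l\triangleleft\mathsf{inr}.\mathrm{id}_S\}$. **Symbolic reduction.** Let $\rightsquigarrow$ be the least relation on processes that contains the following, where $u,w$ range over variables and basic values, where $\leftrightsquigarrow$ means that both directions are included, and where bound variables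 are named apart so that no free variable is captured: 1. (prefixes) $\mathsf l?(x{:}t).P\|Q\rightsquigarrow\mathsf l?(x{:}t).(P\|Q)$; $\ \mathsf l!u.P\|Q\rightsquigarrow\mathsf l!u.(P\|Q)$; $\ \mathsf l\triangleleft\ell.P\|Q\rightsquigarrow\mathsf l\triangleleft\ell.(P\|Q)$; $\ \mathsf l\triangleright\{P_1,P_2\}\|Q\rightsquigarrow\mathsf l\triangleright\{P_1\|Q,P_2\|Q\}$; symmetrically, $P\|\mathsf r?(x{:}t).Q\rightsquigarrow\mathsf r?(x{:}t).(P\|Q)$; $\ P\|\mathsf r!u.Q\rightsquigarrow\mathsf r!u.(P\|Q)$; $\ P\|\mathsf r\triangleleft\ell.Q\rightsquigarrow\mathsf r\triangleleft\ell.(P\|Q)$; $\ P\|\mathsf r\triangleright\{Q_1,Q_2\}\rightsquigarrow\mathsf r\triangleright\{P\|Q_1,P\|Q_2\}$; and $(\mathrm{if}\ u\ \mathrm{then}\ P_1\ \mathrm{else}\ P_2)\|Q\rightsquigarrow\mathrm{if}\ u\ \mathrm{then}\ P_1\|Q\ \mathrm{else}\ P_2\|Q$; $\ P\|(\mathrm{if}\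 u\ \mathrm{then}\ Q_1\ \mathrm{else}\ Q_2)\rightsquigarrow\mathrm{if}\ u\ \mathrm{then}\ P\|Q_1\ \mathrm{else}\ P\|Q_2$; 2. (swaps) $\mathsf c?(x{:}t).\overline{\mathsf c}?(y{:}s).P\rightsquigarrow\overline{\mathsf c}?(y{:}s).\mathsf c?(x{:}t).P$; $\ \mathsf c!u.\overline{\mathsf c}!w.P\rightsquigarrow\overline{\mathsf c}!w.\mathsf c!u.P$; $\ \mathsf c?(x{:}t).\overline{\mathsf c}!u.P\leftrightsquigarrow\overline{\mathsf c}!u.\mathsf c?(x{:}t).P$ if $u\neq x$; $\ \mathsf c?(x{:}t).\overline{\mathsf c}\triangleleft\ell.P\leftrightsquigarrow\overline{\mathsf c}\triangleleft\ell.\mathsf c?(x{:}t).P$; $\ \mathsf c!u.\overline{\mathsf c}\triangleleft\ell.P\leftrightsquigarrow\overline{\mathsf c}\triangleleft\ell.\mathsf c!u.P$; $\ \mathsf c?(x{:}t).\overline{\mathsf c}\triangleright\{P,Q\}\leftrightsquigarrow\overline{\mathsf c}\triangleright\{\mathsf c?(x{:}t).P,\mathsf c?(x{:}t).Q\}$;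 $\ \mathsf c!u.\overline{\mathsf c}\triangleright\{P,Q\}\leftrightsquigarrow\overline{\mathsf c}\triangleright\{\mathsf c!u.P,\mathsf c!u.Q\}$; $\ \mathsf c\triangleright\{\overline{\mathsf c}\triangleleft\ell.P,\overline{\mathsf c}\triangleleft\ell.Q\}\leftrightsquigarrow\overline{\mathsf c}\triangleleft\ell.\mathsf c\triangleright\{P,Q\}$; $\ \mathsf c\triangleleft\ell.\overline{\mathsf c}\triangleleft\ell'.P\leftrightsquigarrow\overline{\mathsf c}\triangleleft\ell'.\mathsf c\triangleleft\ell.P$; $\ \mathsf c\triangleright\{\overline{\mathsf c}\triangleright\{P_1,Q_1\},\overline{\mathsf c}\triangleright\{P_2,Q_2\}\}\leftrightsquigarrow\overline{\mathsf c}\triangleright\{\mathsf c\triangleright\{P_1,P_2\},\mathsf c\triangleright\{Q_1,Q_2\}\}$; 3. (conditional) $\mathrm{if}\ u\ \mathrm{then}\ \mathsf c!\mathsf{true}.P\ \mathrm{else}\ \mathsf c!\mathsf{false}.P\rightsquigarrow\mathsf c!u.P$; 4. (communication) $\mathsf r!u.P\|\mathsf l?(x{:}t).Q\rightsquigarrow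 P\|Q\{u/x\}$; $\ \mathsf r?(x{:}t).P\|\mathsf l!u.Q\rightsquigarrow P\{u/x\}\|Q$; $\ \mathsf r\triangleleft\ell.P\|\mathsf l\triangleright\{Q_{\mathsf{inl}},Q_{\mathsf{inr}}\}\rightsquigarrow P\|Q_\ell$; $\ \mathsf r\triangleright\{P_{\mathsf{inl}},P_{\mathsf{inr}}\}\|\mathsf l\triangleleft\ell.Q\rightsquigarrow P_\ell\|Q$; 5. (identities) $\mathrm{id}_T\|\mathrm{id}_T\rightsquigarrow\mathrm{id}_T$; and that is closed under the symbolic contexts $\mathcal E::=[\,]\mid\mathsf c?(x{:}t).\mathcal E\mid\mathsf c!e.\mathcal E\mid\mathsf c\triangleleft\ell.\mathcal E\mid\mathsf c\triangleright\{\mathcal E,Q\}\mid\mathsf c\triangleright\{P,\mathcal E\}\mid\mathrm{if}\ e\ \mathrm{then}\ P\ \mathrm{else}\ \mathcal E\mid\mathrm{if}\ e\ \mathrm{then}\ \mathcal E\ \mathrm{else}\ Q$ (whose inputs bind variables of the process put in the hole). Let $\rightsquigarrow^*$ be its reflexive transitive closure. **Theorem.** If $P$ is a closed and typed process and $P\rightsquigarrow^*Q$,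 then $P\approx Q$. -/

import Mathlib

universe u v

namespace Sess

/-! Two-channel session processes.  Processes are represented up to renaming of bound
variables, by de Bruijn indices: an input binds the index `0` of its continuation.
Processes may have free variables. -/

/-- The two channels. -/
inductive Chan where
  | l
  | r

/-- The involution on channels. -/
def Chan.co : Chan → Chan
  | .l => .r
  | .r => .l

/-- The two selectors. -/
inductive Sel where
  | inl
  | inr

/-- The component of a pair `P_inl, P_inr` that a selector picks. -/
def Sel.pick {A : Type*} : Sel → A → A → A
  | .inl, P, _ => P
  | .inr, _, Q => Q

/-- Basic values: the unit value, booleans, integers, and an arbitrary set `X` of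
further values. -/
inductive BVal (X : Type u) where
  | unit
  | bool (b : Bool)
  | int (n : ℤ)
  | other (x : X)

/-- Basic types: `unit`, `bool`, `int`, and an arbitrary set `Y` of further types. -/
inductive BTy (Y : Type v) where
  | unit
  | bool
  | int
  | other (y : Y)

/-- `v ∈ t`.  The relation `ρ` says which values belong to the further types. -/
def BVal.Mem {X : Type u} {Y : Type v} (ρ : BVal X → Y → Prop) (w : BVal X) :
    BTy Y → Prop
  | .unit => w = .unit
  | .bool => ∃ b, w = .bool b
  | .int => ∃ n, w = .int n
  | .other y => ρ w y

/-- Expressions: variables, values, equality tests. -/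
inductive Exp (X : Type u) where
  | var (i : ℕ)
  | val (w : BVal X)
  | eq (e₁ e₂ : Exp X)

/-- The evaluation relation.  A variable has no value. -/
inductive Eval {X : Type u} : Exp X → BVal X → Prop
  | val (w : BVal X) : Eval (.val w) w
  | eq_true {e₁ e₂ : Exp X} {w : BVal X} :
      Eval e₁ w → Eval e₂ w → Eval (.eq e₁ e₂) (.bool true)
  | eq_false {e₁ e₂ : Exp X} {w₁ w₂ : BVal X} :
      Eval e₁ w₁ → Eval e₂ w₂ → w₁ ≠ w₂ → Eval (.eq e₁ e₂) (.bool false)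

/-- Processes. -/
inductive Proc (X : Type u) (Y : Type v) where
  /-- the terminated process -/
  | nil
  /-- input `c?(x : t).P`, binding the index `0` in `P` -/
  | inp (c : Chan) (t : BTy Y) (P : Proc X Y)
  /-- output `c!e.P` -/
  | out (c : Chan) (e : Exp X) (P : Proc X Y)
  /-- selection of the label `ℓ` on `c` -/
  | sel (c : Chan) (ℓ : Sel) (P : Proc X Y)
  /-- branching on `c` -/
  | case (c : Chan) (P Q : Proc X Y)
  /-- conditional -/
  | cond (e : Exp X) (P Q : Proc X Y)
  /-- parallel composition, `P` to the left of `Q` -/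
  | par (P Q : Proc X Y)

section Substitution

variable {X : Type u} {Y : Type v}

/-- Renaming of variables in expressions. -/
def Exp.rename (f : ℕ → ℕ) : Exp X → Exp X
  | .var i => .var (f i)
  | .val w => .val w
  | .eq e₁ e₂ => .eq (e₁.rename f) (e₂.rename f)

/-- A renaming carried under a binder. -/
def liftRen (f : ℕ → ℕ) : ℕ → ℕ
  | 0 => 0
  | i + 1 => f i + 1

/-- Renaming of free variables in processes. -/
def Proc.rename (f : ℕ → ℕ) : Proc X Y → Proc X Y
  | .nil => .nil
  | .inp c t P => .inp c t (P.rename (liftRen f))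
  | .out c e P => .out c (e.rename f) (P.rename f)
  | .sel c ℓ P => .sel c ℓ (P.rename f)
  | .case c P Q => .case c (P.rename f) (Q.rename f)
  | .cond e P Q => .cond (e.rename f) (P.rename f) (Q.rename f)
  | .par P Q => .par (P.rename f) (Q.rename f)

/-- Simultaneous substitution in expressions. -/
def Exp.subst (σ : ℕ → Exp X) : Exp X → Exp X
  | .var i => σ i
  | .val w => .val w
  | .eq e₁ e₂ => .eq (e₁.subst σ) (e₂.subst σ)

/-- A substitution carried under a binder. -/
def liftSub (σ : ℕ → Exp X) : ℕ → Exp X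
  | 0 => .var 0
  | i + 1 => (σ i).rename Nat.succ

/-- Simultaneous capture-avoiding substitution for the free variables of a process. -/
def Proc.subst (σ : ℕ → Exp X) : Proc X Y → Proc X Y
  | .nil => .nil
  | .inp c t P => .inp c t (P.subst (liftSub σ))
  | .out c e P => .out c (e.subst σ) (P.subst σ)
  | .sel c ℓ P => .sel c ℓ (P.subst σ)
  | .case c P Q => .case c (P.subst σ) (Q.subst σ)
  | .cond e P Q => .cond (e.subst σ) (P.subst σ) (Q.subst σ)
  | .par P Q => .par (P.subst σ) (Q.subst σ)

/-- The substitution of `e` for the index `0`, the other indices being lowered by one. -/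
def instSub (e : Exp X) : ℕ → Exp X
  | 0 => e
  | i + 1 => .var i

/-- `P{e/x}` for the continuation `P` of an input, `x` being the variable of the input. -/
def Proc.inst (P : Proc X Y) (e : Exp X) : Proc X Y := P.subst (instSub e)

/-- `P` placed under one more binder, whose variable does not occur in `P`. -/
def Proc.shift (P : Proc X Y) : Proc X Y := P.rename Nat.succ

/-- The transposition of the indices `0` and `1`. -/
def swapRen : ℕ → ℕ
  | 0 => 1
  | 1 => 0
  | i + 2 => i + 2

/-- `P` after the exchange of the two innermost binders above it. -/
def Proc.exch (P : Proc X Y) : Proc X Y := P.rename swapRen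

/-- All variables of the expression are below `k`. -/
def Exp.ClosedAt (k : ℕ) : Exp X → Prop
  | .var i => i < k
  | .val _ => True
  | .eq e₁ e₂ => e₁.ClosedAt k ∧ e₂.ClosedAt k

/-- All free variables of the process are below `k`. -/
def Proc.ClosedAt : ℕ → Proc X Y → Prop
  | _, .nil => True
  | k, .inp _ _ P => P.ClosedAt (k + 1)
  | k, .out _ e P => e.ClosedAt k ∧ P.ClosedAt k
  | k, .sel _ _ P => P.ClosedAt k
  | k, .case _ P Q => P.ClosedAt k ∧ Q.ClosedAt k
  | k, .cond e P Q => e.ClosedAt k ∧ P.ClosedAt k ∧ Q.ClosedAt k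
  | k, .par P Q => P.ClosedAt k ∧ Q.ClosedAt k

/-- A process without free variables. -/
def Proc.Closed (P : Proc X Y) : Prop := P.ClosedAt 0

end Substitution

section Semantics

variable {X : Type u} {Y : Type v}

/-- Structural congruence: the least congruence with `0 ‖ 0 ≡ 0` and associativity. -/
inductive SCong : Proc X Y → Proc X Y → Prop
  | nil_nil : SCong (.par .nil .nil) .nil
  | assoc (P Q R : Proc X Y) : SCong (.par P (.par Q R)) (.par (.par P Q) R)
  | refl (P : Proc X Y) : SCong P P
  | symm {P Q : Proc X Y} : SCong P Q → SCong Q P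
  | trans {P Q R : Proc X Y} : SCong P Q → SCong Q R → SCong P R
  | inp (c : Chan) (t : BTy Y) {P P' : Proc X Y} :
      SCong P P' → SCong (.inp c t P) (.inp c t P')
  | out (c : Chan) (e : Exp X) {P P' : Proc X Y} :
      SCong P P' → SCong (.out c e P) (.out c e P')
  | sel (c : Chan) (ℓ : Sel) {P P' : Proc X Y} :
      SCong P P' → SCong (.sel c ℓ P) (.sel c ℓ P')
  | case (c : Chan) {P P' Q Q' : Proc X Y} :
      SCong P P' → SCong Q Q' → SCong (.case c P Q) (.case c P' Q')
  | cond (e : Exp X) {P P' Q Q' : Proc X Y} :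
      SCong P P' → SCong Q Q' → SCong (.cond e P Q) (.cond e P' Q')
  | par {P P' Q Q' : Proc X Y} :
      SCong P P' → SCong Q Q' → SCong (.par P Q) (.par P' Q')

/-- Reduction contexts. -/
inductive RCtx (X : Type u) (Y : Type v) where
  | hole
  | parL (C : RCtx X Y) (P : Proc X Y)
  | parR (P : Proc X Y) (C : RCtx X Y)

/-- `C[P]`. -/
def RCtx.fill : RCtx X Y → Proc X Y → Proc X Y
  | .hole, P => P
  | .parL C R, P => .par (C.fill P) R
  | .parR R C, P => .par R (C.fill P)

/-- Reduction. -/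
inductive Red (ρ : BVal X → Y → Prop) : Proc X Y → Proc X Y → Prop
  | comm₁ {e : Exp X} {w : BVal X} {t : BTy Y} {P Q : Proc X Y} :
      Eval e w → w.Mem ρ t →
      Red ρ (.par (.out .r e P) (.inp .l t Q)) (.par P (Q.inst (.val w)))
  | comm₂ {e : Exp X} {w : BVal X} {t : BTy Y} {P Q : Proc X Y} :
      Eval e w → w.Mem ρ t →
      Red ρ (.par (.inp .r t P) (.out .l e Q)) (.par (P.inst (.val w)) Q)
  | choice₁ {ℓ : Sel} {P Q₁ Q₂ : Proc X Y} :
      Red ρ (.par (.sel .r ℓ P) (.case .l Q₁ Q₂)) (.par P (ℓ.pick Q₁ Q₂))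
  | choice₂ {ℓ : Sel} {P₁ P₂ Q : Proc X Y} :
      Red ρ (.par (.case .r P₁ P₂) (.sel .l ℓ Q)) (.par (ℓ.pick P₁ P₂) Q)
  | cond {e : Exp X} {b : Bool} {P Q : Proc X Y} :
      Eval e (.bool b) → Red ρ (.cond e P Q) (if b then P else Q)
  | context (C : RCtx X Y) {P Q : Proc X Y} :
      Red ρ P Q → Red ρ (C.fill P) (C.fill Q)
  | struct {P P' Q' Q : Proc X Y} :
      SCong P P' → Red ρ P' Q' → SCong Q' Q → Red ρ P Q

/-- A process is correct if every irreducible process that it reduces to is structurally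
congruent to the terminated process. -/
def Correct (ρ : BVal X → Y → Prop) (P : Proc X Y) : Prop :=
  ∀ Q, Relation.ReflTransGen (Red ρ) P Q → (¬ ∃ R, Red ρ Q R) → SCong Q .nil

/-- Process equivalence: the same reduction contexts yield a correct process. -/
def Equiv (ρ : BVal X → Y → Prop) (P Q : Proc X Y) : Prop :=
  ∀ C : RCtx X Y, Correct ρ (C.fill P) ↔ Correct ρ (C.fill Q)

end Semantics

section Typing

variable {X : Type u} {Y : Type v}

/-- Session types. -/
inductive SType (Y : Type v) where
  | fin
  | inp (t : BTy Y) (T : SType Y)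
  | out (t : BTy Y) (T : SType Y)
  | branch (T S : SType Y)
  | select (T S : SType Y)

/-- The dual session type. -/
def SType.dual : SType Y → SType Y
  | .fin => .fin
  | .inp t T => .out t T.dual
  | .out t T => .inp t T.dual
  | .branch T S => .select T.dual S.dual
  | .select T S => .branch T.dual S.dual

/-- Typing of expressions.  The `i`-th entry of the environment is the type of the index
`i`. -/
inductive ETyped (ρ : BVal X → Y → Prop) (Γ : List (BTy Y)) : Exp X → BTy Y → Prop
  | var {i : ℕ} {t : BTy Y} : Γ[i]? = some t → ETyped ρ Γ (.var i) t
  | val {w : BVal X} {t : BTy Y} : w.Mem ρ t → ETyped ρ Γ (.val w) t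
  | eq {e₁ e₂ : Exp X} {t : BTy Y} :
      ETyped ρ Γ e₁ t → ETyped ρ Γ e₂ t → ETyped ρ Γ (.eq e₁ e₂) .bool

/-- `PTyped ρ Γ P T S`: in the environment `Γ`, the process `P` uses the left channel
according to `T` and the right channel according to `S`.  The rules for a prefix on a
channel `c` are written out for `c = l` and for `c = r`. -/
inductive PTyped (ρ : BVal X → Y → Prop) :
    List (BTy Y) → Proc X Y → SType Y → SType Y → Prop
  | idle {Γ} : PTyped ρ Γ .nil .fin .fin
  | inp_l {Γ t P T S} :
      PTyped ρ (t :: Γ) P T S → PTyped ρ Γ (.inp .l t P) (.inp t T) S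
  | inp_r {Γ t P T S} :
      PTyped ρ (t :: Γ) P T S → PTyped ρ Γ (.inp .r t P) T (.inp t S)
  | out_l {Γ e t P T S} : ETyped ρ Γ e t →
      PTyped ρ Γ P T S → PTyped ρ Γ (.out .l e P) (.out t T) S
  | out_r {Γ e t P T S} : ETyped ρ Γ e t →
      PTyped ρ Γ P T S → PTyped ρ Γ (.out .r e P) T (.out t S)
  | case_l {Γ P₁ P₂ T₁ T₂ S} : PTyped ρ Γ P₁ T₁ S →
      PTyped ρ Γ P₂ T₂ S → PTyped ρ Γ (.case .l P₁ P₂) (.branch T₁ T₂) S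
  | case_r {Γ P₁ P₂ T S₁ S₂} : PTyped ρ Γ P₁ T S₁ →
      PTyped ρ Γ P₂ T S₂ → PTyped ρ Γ (.case .r P₁ P₂) T (.branch S₁ S₂)
  | inl_l {Γ P T₁ T₂ S} :
      PTyped ρ Γ P T₁ S → PTyped ρ Γ (.sel .l .inl P) (.select T₁ T₂) S
  | inl_r {Γ P T S₁ S₂} :
      PTyped ρ Γ P T S₁ → PTyped ρ Γ (.sel .r .inl P) T (.select S₁ S₂)
  | inr_l {Γ P T₁ T₂ S} :
      PTyped ρ Γ P T₂ S → PTyped ρ Γ (.sel .l .inr P) (.select T₁ T₂) S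
  | inr_r {Γ P T S₁ S₂} :
      PTyped ρ Γ P T S₂ → PTyped ρ Γ (.sel .r .inr P) T (.select S₁ S₂)
  | cond {Γ e P₁ P₂ T S} : ETyped ρ Γ e .bool → PTyped ρ Γ P₁ T S →
      PTyped ρ Γ P₂ T S → PTyped ρ Γ (.cond e P₁ P₂) T S
  | par {Γ P Q T T' S} : PTyped ρ Γ P T T' →
      PTyped ρ Γ Q T'.dual S → PTyped ρ Γ (.par P Q) T S

end Typing

section Symbolic

/-- The identity process of a session type. -/
def idProc (X : Type u) {Y : Type v} : SType Y → Proc X Y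
  | .fin => .nil
  | .out t T => .inp .l t (.out .r (.var 0) (idProc X T))
  | .inp t T => .inp .r t (.out .l (.var 0) (idProc X T))
  | .select T S => .case .l (.sel .r .inl (idProc X T)) (.sel .r .inr (idProc X S))
  | .branch T S => .case .r (.sel .l .inl (idProc X T)) (.sel .l .inr (idProc X S))

variable {X : Type u} {Y : Type v}

/-- Symbolic reduction contexts. -/
inductive ECtx (X : Type u) (Y : Type v) where
  | hole
  | inp (c : Chan) (t : BTy Y) (E : ECtx X Y)
  | out (c : Chan) (e : Exp X) (E : ECtx X Y)
  | sel (c : Chan) (ℓ : Sel) (E : ECtx X Y)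
  | caseL (c : Chan) (E : ECtx X Y) (Q : Proc X Y)
  | caseR (c : Chan) (P : Proc X Y) (E : ECtx X Y)
  | condL (e : Exp X) (E : ECtx X Y) (Q : Proc X Y)
  | condR (e : Exp X) (P : Proc X Y) (E : ECtx X Y)

/-- `E[P]`; the inputs of `E` above the hole bind the variables of `P`. -/
def ECtx.fill : ECtx X Y → Proc X Y → Proc X Y
  | .hole, P => P
  | .inp c t E, P => .inp c t (E.fill P)
  | .out c e E, P => .out c e (E.fill P)
  | .sel c ℓ E, P => .sel c ℓ (E.fill P)
  | .caseL c E Q, P => .case c (E.fill P) Q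
  | .caseR c R E, P => .case c R (E.fill P)
  | .condL e E Q, P => .cond e (E.fill P) Q
  | .condR e R E, P => .cond e R (E.fill P)

/-- What symbolic reduction handles as the object of an output or of a conditional: a
variable or a value. -/
inductive Atom (X : Type u) where
  | var (i : ℕ)
  | val (w : BVal X)

/-- An atom as an expression. -/
def Atom.exp : Atom X → Exp X
  | .var i => .var i
  | .val w => .val w

/-- An atom placed under one more binder, whose variable does not occur in it. -/
def Atom.shift : Atom X → Atom X
  | .var i => .var (i + 1)
  | .val w => .val w

/-- The swap rules that are used in both directions.  In `inp_out` the input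
does not bind the variable that is output. -/
inductive Swap : Proc X Y → Proc X Y → Prop
  | inp_out (c : Chan) (t : BTy Y) (y : Atom X) (P : Proc X Y) :
      Swap (.inp c t (.out c.co y.shift.exp P)) (.out c.co y.exp (.inp c t P))
  | inp_sel (c : Chan) (t : BTy Y) (ℓ : Sel) (P : Proc X Y) :
      Swap (.inp c t (.sel c.co ℓ P)) (.sel c.co ℓ (.inp c t P))
  | out_sel (c : Chan) (x : Atom X) (ℓ : Sel) (P : Proc X Y) :
      Swap (.out c x.exp (.sel c.co ℓ P)) (.sel c.co ℓ (.out c x.exp P))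
  | inp_case (c : Chan) (t : BTy Y) (P Q : Proc X Y) :
      Swap (.inp c t (.case c.co P Q)) (.case c.co (.inp c t P) (.inp c t Q))
  | out_case (c : Chan) (x : Atom X) (P Q : Proc X Y) :
      Swap (.out c x.exp (.case c.co P Q))
        (.case c.co (.out c x.exp P) (.out c x.exp Q))
  | case_sel (c : Chan) (ℓ : Sel) (P Q : Proc X Y) :
      Swap (.case c (.sel c.co ℓ P) (.sel c.co ℓ Q)) (.sel c.co ℓ (.case c P Q))
  | sel_sel (c : Chan) (ℓ ℓ' : Sel) (P : Proc X Y) :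
      Swap (.sel c ℓ (.sel c.co ℓ' P)) (.sel c.co ℓ' (.sel c ℓ P))
  | case_case (c : Chan) (P₁ Q₁ P₂ Q₂ : Proc X Y) :
      Swap (.case c (.case c.co P₁ Q₁) (.case c.co P₂ Q₂))
        (.case c.co (.case c P₁ P₂) (.case c Q₁ Q₂))

/-- Symbolic reduction. -/
inductive SRed : Proc X Y → Proc X Y → Prop
  | up₁ (t : BTy Y) (P Q : Proc X Y) :
      SRed (.par (.inp .l t P) Q) (.inp .l t (.par P Q.shift))
  | up₂ (t : BTy Y) (P Q : Proc X Y) :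
      SRed (.par P (.inp .r t Q)) (.inp .r t (.par P.shift Q))
  | up₃ (x : Atom X) (P Q : Proc X Y) :
      SRed (.par (.out .l x.exp P) Q) (.out .l x.exp (.par P Q))
  | up₄ (x : Atom X) (P Q : Proc X Y) :
      SRed (.par P (.out .r x.exp Q)) (.out .r x.exp (.par P Q))
  | up₅ (P₁ P₂ Q : Proc X Y) :
      SRed (.par (.case .l P₁ P₂) Q) (.case .l (.par P₁ Q) (.par P₂ Q))
  | up₆ (P Q₁ Q₂ : Proc X Y) :
      SRed (.par P (.case .r Q₁ Q₂)) (.case .r (.par P Q₁) (.par P Q₂))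
  | up₇ (ℓ : Sel) (P Q : Proc X Y) :
      SRed (.par (.sel .l ℓ P) Q) (.sel .l ℓ (.par P Q))
  | up₈ (ℓ : Sel) (P Q : Proc X Y) :
      SRed (.par P (.sel .r ℓ Q)) (.sel .r ℓ (.par P Q))
  | up₉ (x : Atom X) (P₁ P₂ Q : Proc X Y) :
      SRed (.par (.cond x.exp P₁ P₂) Q) (.cond x.exp (.par P₁ Q) (.par P₂ Q))
  | up₁₀ (x : Atom X) (P Q₁ Q₂ : Proc X Y) :
      SRed (.par P (.cond x.exp Q₁ Q₂)) (.cond x.exp (.par P Q₁) (.par P Q₂))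
  | swap₁ (c : Chan) (t s : BTy Y) (P : Proc X Y) :
      SRed (.inp c t (.inp c.co s P)) (.inp c.co s (.inp c t P.exch))
  | swap₂ (c : Chan) (x y : Atom X) (P : Proc X Y) :
      SRed (.out c x.exp (.out c.co y.exp P)) (.out c.co y.exp (.out c x.exp P))
  | swap {P Q : Proc X Y} : Swap P Q → SRed P Q
  | swap_rev {P Q : Proc X Y} : Swap P Q → SRed Q P
  | cond (c : Chan) (x : Atom X) (P : Proc X Y) :
      SRed (.cond x.exp (.out c (.val (.bool true)) P) (.out c (.val (.bool false)) P))
        (.out c x.exp P)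
  | comm₁ (y : Atom X) (t : BTy Y) (P Q : Proc X Y) :
      SRed (.par (.out .r y.exp P) (.inp .l t Q)) (.par P (Q.inst y.exp))
  | comm₂ (y : Atom X) (t : BTy Y) (P Q : Proc X Y) :
      SRed (.par (.inp .r t P) (.out .l y.exp Q)) (.par (P.inst y.exp) Q)
  | choice₁ (ℓ : Sel) (P Q₁ Q₂ : Proc X Y) :
      SRed (.par (.sel .r ℓ P) (.case .l Q₁ Q₂)) (.par P (ℓ.pick Q₁ Q₂))
  | choice₂ (ℓ : Sel) (P₁ P₂ Q : Proc X Y) :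
      SRed (.par (.case .r P₁ P₂) (.sel .l ℓ Q)) (.par (ℓ.pick P₁ P₂) Q)
  | id (T : SType Y) :
      SRed (.par (idProc X T) (idProc X T)) (idProc X T)
  | contexts (E : ECtx X Y) {P Q : Proc X Y} :
      SRed P Q → SRed (E.fill P) (E.fill Q)

end Symbolic

end Sess

/-! Flatten a process into a configuration: a list in which compositions are split, conditionals are
decided, and adjacent members communicate. A prefix uses one channel, hence one neighbour, so every
member lies in at most one redex and steps have the diamond property (`Step.diamond`). Call a list
good if it can reach a list of terminated processes. By confluence goodness is invariant under steps
in both directions (`Steps.good_iff`). Reduction terminates, so a process is correct exactly when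
its singleton list is good (`correct_iff_good`), and it suffices to prove `TEquiv`, the equality of
goodness in every list context.

Goodness has a compositional description (`good_plug_iff` and its instances): a process with a
prefix on one channel is good between two lists iff the list on that side can, after steps of its
own, offer the complementary action, with a good result. Prefixes on the two channels put
independent existential conditions on the two lists. Swapping them exchanges quantifiers; pulling a
prefix out of a composition changes only which member is in focus. Two adjacent copies of an
identity amount to one because the second consumes what the first forwards.

Symbolic reduction also acts under inputs, on open processes. The invariant is therefore `SemEquiv`:
equivalence after every substitution of values of the assumed types. Typing enters only where an
atom must have become a value of the right type, in the communication of a value and in the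
conditional rule. To be available at each step it must be preserved (`SRed.typed`). The conditional
rule can turn an output of two booleans at a larger type into the output of a `bool` variable, so
preservation holds for typing up to inclusion of basic types. -/

namespace Sess

/-! ### Configurations: lists of processes -/

section Configurations

variable {X : Type u} {Y : Type v} {ρ : BVal X → Y → Prop}

/-- The communication actions. -/
inductive Action (X : Type u) where
  | send (w : BVal X)
  | recv (w : BVal X)
  | choose (ℓ : Sel)
  | offer (ℓ : Sel)

/-- The complementary action. -/
def Action.dual : Action X → Action X
  | .send w => .recv w
  | .recv w => .send w
  | .choose ℓ => .offer ℓ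
  | .offer ℓ => .choose ℓ

/-- `Act ρ P c α P'`: the prefix of `P` performs `α` on the channel `c`. -/
inductive Act (ρ : BVal X → Y → Prop) : Proc X Y → Chan → Action X → Proc X Y → Prop
  | out {c : Chan} {e : Exp X} {w : BVal X} {P : Proc X Y} :
      Eval e w → Act ρ (.out c e P) c (.send w) P
  | inp {c : Chan} {t : BTy Y} {w : BVal X} {P : Proc X Y} :
      w.Mem ρ t → Act ρ (.inp c t P) c (.recv w) (P.inst (.val w))
  | sel {c : Chan} {ℓ : Sel} {P : Proc X Y} : Act ρ (.sel c ℓ P) c (.choose ℓ) P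
  | case {c : Chan} {ℓ : Sel} {P Q : Proc X Y} :
      Act ρ (.case c P Q) c (.offer ℓ) (ℓ.pick P Q)

/-- Internal steps of a single process: splitting a composition, deciding a conditional. -/
inductive Loc : Proc X Y → List (Proc X Y) → Prop
  | par (P Q : Proc X Y) : Loc (.par P Q) [P, Q]
  | cond {e : Exp X} {b : Bool} {P Q : Proc X Y} :
      Eval e (.bool b) → Loc (.cond e P Q) [if b then P else Q]

/-- Steps of a list of processes. -/
inductive Step (ρ : BVal X → Y → Prop) : List (Proc X Y) → List (Proc X Y) → Prop
  | loc {a : Proc X Y} {l : List (Proc X Y)} (L : List (Proc X Y)) :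
      Loc a l → Step ρ (a :: L) (l ++ L)
  | com {a b a' b' : Proc X Y} {α : Action X} (L : List (Proc X Y)) :
      Act ρ a .r α a' → Act ρ b .l α.dual b' → Step ρ (a :: b :: L) (a' :: b' :: L)
  | tail (a : Proc X Y) {L L' : List (Proc X Y)} : Step ρ L L' → Step ρ (a :: L) (a :: L')

/-- Sequences of steps. -/
abbrev Steps (ρ : BVal X → Y → Prop) : List (Proc X Y) → List (Proc X Y) → Prop :=
  Relation.ReflTransGen (Step ρ)

/-- The list reduces to a list of terminated processes. -/
def Good (ρ : BVal X → Y → Prop) (L : List (Proc X Y)) : Prop :=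
  ∃ M, Steps ρ L M ∧ ∀ P ∈ M, P = .nil

/-- The channel of the prefix of a process. -/
def Proc.chan : Proc X Y → Option Chan
  | .nil => none
  | .inp c _ _ => some c
  | .out c _ _ => some c
  | .sel c _ _ => some c
  | .case c _ _ => some c
  | .cond _ _ _ => none
  | .par _ _ => none

/-! ### Confluence, and invariance of goodness under steps -/

theorem Eval.det {e : Exp X} {w w' : BVal X} (h : Eval e w) (h' : Eval e w') : w = w' := by
  induction h generalizing w' with
  | val => cases h'; rfl
  | eq_true _ _ ih₁ ih₂ =>
    cases h' with
    | eq_true => rfl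
    | eq_false h₁ h₂ hne => exact absurd ((ih₁ h₁).symm.trans (ih₂ h₂)) hne
  | eq_false _ _ hne ih₁ ih₂ =>
    cases h' with
    | eq_true h₁ h₂ => exact absurd ((ih₁ h₁).trans (ih₂ h₂).symm) hne
    | eq_false => rfl

theorem Act.chan_eq {P P' : Proc X Y} {c : Chan} {α : Action X} (h : Act ρ P c α P') :
    P.chan = some c := by
  cases h <;> rfl

theorem Loc.chan_eq {P : Proc X Y} {l : List (Proc X Y)} (h : Loc P l) : P.chan = none := by
  cases h <;> rfl

theorem Loc.det {P : Proc X Y} {l l' : List (Proc X Y)} (h : Loc P l) (h' : Loc P l') :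
    l = l' := by
  cases h with
  | par => cases h'; rfl
  | cond h₁ =>
    cases h' with
    | cond h₂ =>
      have := h₁.det h₂
      simp only [BVal.bool.injEq] at this
      rw [this]

/-- A single input or branching may act in many ways, but its partner fixes the value or the label,
and evaluation is deterministic. -/
theorem Act.det {a b a₁ b₁ a₂ b₂ : Proc X Y} {c d : Chan} {α β : Action X}
    (ha : Act ρ a c α a₁) (hb : Act ρ b d α.dual b₁)
    (ha' : Act ρ a c β a₂) (hb' : Act ρ b d β.dual b₂) : a₁ = a₂ ∧ b₁ = b₂ := by
  cases ha <;> cases ha' <;> cases hb <;> cases hb' <;>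
    first
    | exact ⟨rfl, rfl⟩
    | (rename_i h₁ _ h₂ _ _ _ _; cases Eval.det h₁ h₂; exact ⟨rfl, rfl⟩)
    | (rename_i h₁ h₂; cases Eval.det h₁ h₂; exact ⟨rfl, rfl⟩)

theorem Step.append_right {L L' : List (Proc X Y)} (h : Step ρ L L') (M : List (Proc X Y)) :
    Step ρ (L ++ M) (L' ++ M) := by
  induction h with
  | loc L h => simpa using Step.loc (L ++ M) h
  | com L h₁ h₂ => exact Step.com (L ++ M) h₁ h₂
  | tail a _ ih => exact Step.tail a ih

theorem Step.append_left {L L' : List (Proc X Y)} (M : List (Proc X Y)) (h : Step ρ L L') :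
    Step ρ (M ++ L) (M ++ L') := by
  induction M with
  | nil => exact h
  | cons a M ih => exact Step.tail a ih

theorem Steps.append_right {L L' : List (Proc X Y)} (h : Steps ρ L L') (M : List (Proc X Y)) :
    Steps ρ (L ++ M) (L' ++ M) :=
  h.lift (· ++ M) fun _ _ h => h.append_right M

theorem Steps.append_left {L L' : List (Proc X Y)} (M : List (Proc X Y)) (h : Steps ρ L L') :
    Steps ρ (M ++ L) (M ++ L') :=
  h.lift (M ++ ·) fun _ _ h => h.append_left M

theorem Step.tail_of_chan {b : Proc X Y} {L M : List (Proc X Y)} (h : Step ρ (b :: L) M)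
    (hloc : ∀ l, ¬ Loc b l) (hr : b.chan ≠ some .r) : ∃ L', Step ρ L L' ∧ M = b :: L' := by
  cases h with
  | loc _ h => exact absurd h (hloc _)
  | com _ h _ => exact absurd h.chan_eq hr
  | tail _ h => exact ⟨_, h, rfl⟩

theorem not_loc_of_chan {b : Proc X Y} {c : Chan} (h : b.chan = some c)
    (l : List (Proc X Y)) : ¬ Loc b l := fun hl => by
  rw [hl.chan_eq] at h
  cases h

/-- Two redexes either coincide, and then determinism applies, or share no member. In a
communication the second member has its prefix on the left channel, so it cannot also react with
what follows it. -/
theorem Step.diamond {L M N : List (Proc X Y)} (h : Step ρ L M) (h' : Step ρ L N) :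
    M = N ∨ ∃ K, Step ρ M K ∧ Step ρ N K := by
  induction h generalizing N with
  | loc L hl =>
    cases h' with
    | loc _ hl' => exact .inl (by rw [hl.det hl'])
    | com _ h₁ h₂ => exact absurd hl (not_loc_of_chan h₁.chan_eq _)
    | tail _ h => exact .inr ⟨_, h.append_left _, Step.loc _ hl⟩
  | com L h₁ h₂ =>
    cases h' with
    | loc _ hl => exact absurd hl (not_loc_of_chan h₁.chan_eq _)
    | com _ h₃ h₄ =>
      obtain ⟨rfl, rfl⟩ := Act.det h₁ h₂ h₃ h₄
      exact .inl rfl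
    | tail _ h =>
      obtain ⟨L', hL, rfl⟩ := h.tail_of_chan (not_loc_of_chan h₂.chan_eq)
        (by rw [h₂.chan_eq]; simp)
      exact .inr ⟨_, .tail _ (.tail _ hL), .com _ h₁ h₂⟩
  | tail a hL ih =>
    cases h' with
    | loc _ hl => exact .inr ⟨_, Step.loc _ hl, hL.append_left _⟩
    | com _ h₁ h₂ =>
      obtain ⟨L', hL', rfl⟩ := hL.tail_of_chan (not_loc_of_chan h₂.chan_eq)
        (by rw [h₂.chan_eq]; simp)
      exact .inr ⟨_, .com _ h₁ h₂, .tail _ (.tail _ hL')⟩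
    | tail _ h =>
      rcases ih h with rfl | ⟨K, h₁, h₂⟩
      · exact .inl rfl
      · exact .inr ⟨_, .tail _ h₁, .tail _ h₂⟩

theorem Step.exists_ne_nil {L M : List (Proc X Y)} (h : Step ρ L M) : ∃ P ∈ L, P ≠ .nil := by
  induction h with
  | loc L h => exact ⟨_, List.mem_cons_self, fun e => by subst e; cases h⟩
  | com L h _ => exact ⟨_, List.mem_cons_self, fun e => by subst e; cases h⟩
  | tail a _ ih =>
    obtain ⟨P, hP, hne⟩ := ih
    exact ⟨P, List.mem_cons_of_mem _ hP, hne⟩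

theorem Good.of_steps {L M : List (Proc X Y)} (h : Steps ρ L M) (hM : Good ρ M) : Good ρ L := by
  obtain ⟨K, hK, hn⟩ := hM
  exact ⟨K, h.trans hK, hn⟩

theorem Good.steps {L M : List (Proc X Y)} (hL : Good ρ L) (h : Steps ρ L M) : Good ρ M := by
  obtain ⟨K, hK, hn⟩ := hL
  obtain ⟨D, hKD, hMD⟩ := Relation.church_rosser (r := Step ρ) (fun a b c hb hc => by
    rcases hb.diamond hc with rfl | ⟨d, h₁, h₂⟩
    · exact ⟨b, .refl, .refl⟩
    · exact ⟨d, .single h₁, .single h₂⟩) hK h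
  -- A list of terminated processes is irreducible, so the common reduct is that list itself.
  rcases hKD.cases_head with rfl | ⟨K', hs, _⟩
  · exact ⟨K, hMD, hn⟩
  · obtain ⟨P, hP, hne⟩ := hs.exists_ne_nil
    exact absurd (hn P hP) hne

theorem Steps.good_iff {L M : List (Proc X Y)} (h : Steps ρ L M) : Good ρ L ↔ Good ρ M :=
  ⟨fun hL => hL.steps h, Good.of_steps h⟩

theorem Step.good_iff {L M : List (Proc X Y)} (h : Step ρ L M) : Good ρ L ↔ Good ρ M :=
  Steps.good_iff (.single h)

/-- A step is inside one of the two parts or a communication across the boundary. This is what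
allows a fixed member to be followed along a run. -/
theorem Step.append_inv {A B M : List (Proc X Y)} (h : Step ρ (A ++ B) M) :
    (∃ A', Step ρ A A' ∧ M = A' ++ B) ∨ (∃ B', Step ρ B B' ∧ M = A ++ B') ∨
    ∃ A₀ a B₀ b a' b' α, A = A₀ ++ [a] ∧ B = b :: B₀ ∧ Act ρ a .r α a' ∧
      Act ρ b .l α.dual b' ∧ M = A₀ ++ a' :: b' :: B₀ := by
  induction A generalizing M with
  | nil => exact .inr (.inl ⟨M, h, rfl⟩)
  | cons x A ih =>
    rw [List.cons_append] at h
    generalize hK : A ++ B = K at h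
    cases h with
    | loc _ hl =>
      subst hK
      exact .inl ⟨_, Step.loc A hl, by simp⟩
    | com K' h₁ h₂ =>
      cases A with
      | nil => exact .inr (.inr ⟨[], x, K', _, _, _, _, rfl, hK, h₁, h₂, rfl⟩)
      | cons y A =>
        simp only [List.cons_append, List.cons.injEq] at hK
        obtain ⟨rfl, rfl⟩ := hK
        exact .inl ⟨_, Step.com A h₁ h₂, rfl⟩
    | tail _ h =>
      subst hK
      rcases ih h with ⟨A', hA, rfl⟩ | ⟨B', hB, rfl⟩ |
        ⟨A₀, a, B₀, b, a', b', α, rfl, rfl, h₁, h₂, rfl⟩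
      · exact .inl ⟨_, .tail x hA, rfl⟩
      · exact .inr (.inl ⟨_, hB, rfl⟩)
      · exact .inr (.inr ⟨x :: A₀, a, B₀, b, a', b', α, rfl, rfl, h₁, h₂, rfl⟩)

theorem good_nil : Good ρ ([] : List (Proc X Y)) := ⟨[], .refl, by simp⟩

/-- A terminated process separates its two sides. -/
theorem good_append_nil_cons (A B : List (Proc X Y)) :
    Good ρ (A ++ .nil :: B) ↔ Good ρ A ∧ Good ρ B := by
  constructor
  · rintro ⟨M, h, hM⟩
    generalize hL : A ++ .nil :: B = L at h
    induction h using Relation.ReflTransGen.head_induction_on generalizing A B with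
    | refl =>
      subst hL
      exact ⟨⟨A, .refl, fun P hP => hM P (by simp [hP])⟩,
        ⟨B, .refl, fun P hP => hM P (by simp [hP])⟩⟩
    | head hs _ ih =>
      subst hL
      rcases hs.append_inv with ⟨A', hA, rfl⟩ | ⟨B', hB, rfl⟩ |
        ⟨A₀, a, B₀, b, a', b', α, rfl, hB, h₁, h₂, rfl⟩
      · obtain ⟨h₁, h₂⟩ := ih A' B rfl
        exact ⟨hA.good_iff.2 h₁, h₂⟩
      · obtain ⟨B'', hB', rfl⟩ := hB.tail_of_chan (fun _ h => by cases h) (by simp [Proc.chan])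
        obtain ⟨h₁, h₂⟩ := ih A B'' rfl
        exact ⟨h₁, hB'.good_iff.2 h₂⟩
      -- A communication across the boundary would need an action of the terminated process.
      · cases hB
        cases h₂
  · rintro ⟨⟨M, hM, hMn⟩, ⟨N, hN, hNn⟩⟩
    refine ⟨M ++ .nil :: N, (hM.append_right _).trans
      (Steps.append_left M (Steps.append_left [.nil] hN)), ?_⟩
    intro P hP
    simp only [List.mem_append, List.mem_cons] at hP
    rcases hP with h | h | h
    exacts [hMn P h, h, hNn P h]

/-! ### A process between two lists -/

/-- The list with `P` in the middle, `N` on the side of the channel `c` and `F` on the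
other side; both lists start at the neighbour of `P`. -/
def plug : Chan → List (Proc X Y) → Proc X Y → List (Proc X Y) → List (Proc X Y)
  | .l, N, P, F => N.reverse ++ P :: F
  | .r, N, P, F => F.reverse ++ P :: N

/-- Steps of the list on the side of `c`. -/
def SideSteps (ρ : BVal X → Y → Prop) : Chan → List (Proc X Y) → List (Proc X Y) → Prop
  | .l, N, N' => Steps ρ N.reverse N'.reverse
  | .r, N, N' => Steps ρ N N'

/-- The list on the side of `c` performs `α` towards the middle after some steps. -/
def Weak (ρ : BVal X → Y → Prop) (c : Chan) (N : List (Proc X Y)) (α : Action X)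
    (N' : List (Proc X Y)) : Prop :=
  ∃ b N₀ b', SideSteps ρ c N (b :: N₀) ∧ Act ρ b c.co α b' ∧ N' = b' :: N₀

/-- The left-right symmetry: statements about one side transfer to the other through it. -/
theorem plug_co (c : Chan) (N F : List (Proc X Y)) (P : Proc X Y) :
    plug c.co F P N = plug c N P F := by
  cases c <;> rfl

theorem SideSteps.head {c : Chan} {N N' N'' : List (Proc X Y)} (h : SideSteps ρ c N N')
    (h' : SideSteps ρ c N' N'') : SideSteps ρ c N N'' := by
  cases c <;> exact Relation.ReflTransGen.trans h h'

theorem SideSteps.refl (c : Chan) (N : List (Proc X Y)) : SideSteps ρ c N N := by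
  cases c <;> exact Relation.ReflTransGen.refl

theorem SideSteps.plug {c : Chan} {N N' : List (Proc X Y)} (h : SideSteps ρ c N N')
    (P : Proc X Y) (F : List (Proc X Y)) : Steps ρ (plug c N P F) (plug c N' P F) := by
  cases c
  · exact Steps.append_right h (P :: F)
  · exact Steps.append_left F.reverse (Steps.append_left [P] h)

theorem Action.dual_dual (α : Action X) : α.dual.dual = α := by
  cases α <;> rfl

theorem step_plug {c : Chan} {N F : List (Proc X Y)} {a b a' b' : Proc X Y} {α : Action X}
    (ha : Act ρ a c α a') (hb : Act ρ b c.co α.dual b') :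
    Step ρ (plug c (b :: N) a F) (plug c (b' :: N) a' F) := by
  cases c
  · simp only [plug, List.reverse_cons, List.append_assoc, List.singleton_append]
    exact Step.append_left _ (.com F hb (by rwa [Action.dual_dual]))
  · exact Step.append_left _ (.com N ha hb)

/-- A member with a prefix on `c` has no internal step and ignores its other neighbour. -/
theorem step_plug_inv {c : Chan} {N F M : List (Proc X Y)} {a : Proc X Y}
    (hc : a.chan = some c) (h : Step ρ (plug c N a F) M) :
    (∃ N', SideSteps ρ c N N' ∧ M = plug c N' a F) ∨
    (∃ F', SideSteps ρ c.co F F' ∧ M = plug c N a F') ∨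
    ∃ N₀ b a' b' α, N = b :: N₀ ∧ Act ρ a c α a' ∧ Act ρ b c.co α.dual b' ∧
      M = plug c (b' :: N₀) a' F := by
  cases c
  · rcases h.append_inv with ⟨A', hA, rfl⟩ | ⟨B', hB, rfl⟩ |
      ⟨A₀, b, B₀, a₀, b', a', α, hA, hB, h₁, h₂, rfl⟩
    · refine .inl ⟨A'.reverse, ?_, by simp [plug]⟩
      simpa [SideSteps] using Relation.ReflTransGen.single hA
    · obtain ⟨F', hF, rfl⟩ := hB.tail_of_chan (not_loc_of_chan hc) (by simp [hc])
      exact .inr (.inl ⟨F', .single hF, rfl⟩)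
    · cases hB
      refine .inr (.inr ⟨A₀.reverse, b, a', b', α.dual, ?_, h₂, ?_, by simp [plug]⟩)
      · simpa using congrArg List.reverse hA
      · rwa [Action.dual_dual]
  · rcases h.append_inv with ⟨A', hA, rfl⟩ | ⟨B', hB, rfl⟩ |
      ⟨A₀, b, B₀, a₀, b', a', α, hA, hB, h₁, h₂, rfl⟩
    · refine .inr (.inl ⟨A'.reverse, ?_, by simp [plug]⟩)
      simpa [SideSteps, Chan.co] using Relation.ReflTransGen.single hA
    · cases hB with
      | loc _ hl => exact absurd hl (not_loc_of_chan hc _)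
      | com N₀ h₁ h₂ => exact .inr (.inr ⟨N₀, _, _, _, _, rfl, h₁, h₂, rfl⟩)
      | tail _ hN => exact .inl ⟨_, .single hN, rfl⟩
    · cases hB
      have := h₂.chan_eq
      rw [hc] at this
      cases this

/-- A prefix on `c` has to be consumed by the list on the side of `c`. -/
theorem good_plug_iff {c : Chan} {a : Proc X Y} (hc : a.chan = some c)
    (N F : List (Proc X Y)) :
    Good ρ (plug c N a F) ↔
      ∃ α a' N', Act ρ a c α a' ∧ Weak ρ c N α.dual N' ∧ Good ρ (plug c N' a' F) := by
  constructor
  · intro hg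
    have hg' := hg
    obtain ⟨M, h, hM⟩ := hg
    generalize hL : plug c N a F = L at h
    induction h using Relation.ReflTransGen.head_induction_on generalizing N F with
    | refl =>
      subst hL
      have : a = .nil := hM a (by cases c <;> simp [plug])
      subst this
      cases hc
    | head hs hss ih =>
      subst hL
      rcases step_plug_inv hc hs with ⟨N', hN, rfl⟩ | ⟨F', hF, rfl⟩ |
        ⟨N₀, b, a', b', α, rfl, h₁, h₂, rfl⟩
      -- Steps of the near list are prepended to its weak action.
      · obtain ⟨α, a', N'', ha, ⟨b, N₀, b', h₁, h₂, rfl⟩, h₃⟩ := ih N' F (hs.good_iff.1 hg') rfl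
        exact ⟨α, a', _, ha, ⟨b, N₀, b', hN.head h₁, h₂, rfl⟩, h₃⟩
      · obtain ⟨α, a', N'', ha, hw, h₃⟩ := ih N F' (hs.good_iff.1 hg') rfl
        refine ⟨α, a', N'', ha, hw, ?_⟩
        -- Steps of the far list are undone after the prefix has been consumed, by invariance of
        -- goodness; hence the conclusion mentions the original `F`.
        have := (hF.plug a' N'').good_iff
        rw [plug_co, plug_co] at this
        exact this.2 h₃
      · exact ⟨α, a', _, h₁, ⟨b, N₀, b', .refl _ _, h₂, rfl⟩, hs.good_iff.1 hg'⟩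
  · rintro ⟨α, a', N', ha, ⟨b, N₀, b', h₁, h₂, rfl⟩, h₃⟩
    exact (h₁.plug a F).good_iff.2 ((step_plug ha h₂).good_iff.2 h₃)

theorem good_inp (c : Chan) (t : BTy Y) (P : Proc X Y) (N F : List (Proc X Y)) :
    Good ρ (plug c N (.inp c t P) F) ↔ ∃ w N', w.Mem ρ t ∧ Weak ρ c N (.send w) N' ∧
      Good ρ (plug c N' (P.inst (.val w)) F) := by
  rw [good_plug_iff rfl]
  constructor
  · rintro ⟨α, a', N', h, hw, hg⟩
    cases h with
    | inp hm => exact ⟨_, N', hm, hw, hg⟩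
  · rintro ⟨w, N', hm, hw, hg⟩
    exact ⟨_, _, N', .inp hm, hw, hg⟩

theorem good_out (c : Chan) (e : Exp X) (P : Proc X Y) (N F : List (Proc X Y)) :
    Good ρ (plug c N (.out c e P) F) ↔ ∃ w N', Eval e w ∧ Weak ρ c N (.recv w) N' ∧
      Good ρ (plug c N' P F) := by
  rw [good_plug_iff rfl]
  constructor
  · rintro ⟨α, a', N', h, hw, hg⟩
    cases h with
    | out hm => exact ⟨_, N', hm, hw, hg⟩
  · rintro ⟨w, N', hm, hw, hg⟩
    exact ⟨_, _, N', .out hm, hw, hg⟩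

theorem good_sel (c : Chan) (ℓ : Sel) (P : Proc X Y) (N F : List (Proc X Y)) :
    Good ρ (plug c N (.sel c ℓ P) F) ↔ ∃ N', Weak ρ c N (.offer ℓ) N' ∧
      Good ρ (plug c N' P F) := by
  rw [good_plug_iff rfl]
  constructor
  · rintro ⟨α, a', N', h, hw, hg⟩
    cases h
    exact ⟨N', hw, hg⟩
  · rintro ⟨N', hw, hg⟩
    exact ⟨_, _, N', .sel, hw, hg⟩

theorem good_case (c : Chan) (P Q : Proc X Y) (N F : List (Proc X Y)) :
    Good ρ (plug c N (.case c P Q) F) ↔ ∃ ℓ N', Weak ρ c N (.choose ℓ) N' ∧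
      Good ρ (plug c N' (ℓ.pick P Q) F) := by
  rw [good_plug_iff rfl]
  constructor
  · rintro ⟨α, a', N', h, hw, hg⟩
    cases h
    exact ⟨_, N', hw, hg⟩
  · rintro ⟨ℓ, N', hw, hg⟩
    exact ⟨_, _, N', .case, hw, hg⟩

/-- Neighbours cannot consume a conditional, so a run to termination must decide it, and by
confluence this may be done at once. -/
theorem good_cond (c : Chan) (e : Exp X) (P Q : Proc X Y) (N F : List (Proc X Y)) :
    Good ρ (plug c N (.cond e P Q) F) ↔ ∃ b : Bool, Eval e (.bool b) ∧
      Good ρ (plug c N (if b then P else Q) F) := by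
  wlog hc : c = .l generalizing c N F
  · have h := this c.co F N (by cases c <;> simp_all [Chan.co])
    simpa only [plug_co] using h
  subst hc
  constructor
  · intro hg
    have hg' := hg
    obtain ⟨M, h, hM⟩ := hg
    generalize hL : plug .l N (.cond e P Q) F = L at h
    induction h using Relation.ReflTransGen.head_induction_on generalizing N F with
    | refl =>
      subst hL
      have := hM (.cond e P Q) (by simp [plug])
      cases this
    | head hs hss ih =>
      subst hL
      have hs' := hs
      rcases hs'.append_inv with ⟨A', hA, rfl⟩ | ⟨B', hB, rfl⟩ |
        ⟨A₀, b, B₀, a₀, b', a', α, hA, hB, h₁, h₂, rfl⟩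
      · obtain ⟨b, hb, h⟩ := ih A'.reverse F
          (by simpa [plug] using hs.good_iff.1 hg') (by simp [plug])
        refine ⟨b, hb, (hA.append_right _).good_iff.2 (by simpa [plug] using h)⟩
      · cases hB with
        | loc _ hl =>
          cases hl with
          | cond hb => exact ⟨_, hb, hs.good_iff.1 hg'⟩
        | com _ h _ => cases h
        | tail _ hF =>
          obtain ⟨b, hb, h⟩ := ih N _ (hs.good_iff.1 hg') rfl
          exact ⟨b, hb, (Step.append_left _ (.tail _ hF)).good_iff.2 h⟩
      · cases hB
        cases h₂
  · rintro ⟨b, hb, hg⟩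
    exact (Step.append_left _ (.loc F (.cond hb))).good_iff.2 hg

theorem good_par (P Q : Proc X Y) (N F : List (Proc X Y)) :
    Good ρ (plug .l N (.par P Q) F) ↔ Good ρ (plug .l N P (Q :: F)) :=
  (Step.append_left _ (.loc F (.par P Q))).good_iff

/-- Moves the focus to the right neighbour. -/
theorem plug_shift (P Q : Proc X Y) (N F : List (Proc X Y)) :
    plug .l N P (Q :: F) = plug .r F Q (P :: N) := by
  simp [plug]

theorem good_nil_cons (B : List (Proc X Y)) : Good ρ (.nil :: B) ↔ Good ρ B := by
  simpa [good_nil] using good_append_nil_cons (ρ := ρ) [] B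

/-! ### Contextual equivalence of configurations is a congruence -/

/-- The two processes have the same contexts in which they are good. -/
def TEquiv (ρ : BVal X → Y → Prop) (P Q : Proc X Y) : Prop :=
  ∀ c N F, Good ρ (plug c N P F) ↔ Good ρ (plug c N Q F)

theorem TEquiv.of_chan (c : Chan) {P Q : Proc X Y}
    (h : ∀ N F, Good ρ (plug c N P F) ↔ Good ρ (plug c N Q F)) : TEquiv ρ P Q := by
  intro d N F
  by_cases hd : d = c
  · subst hd
    exact h N F
  · have : c = d.co := by cases c <;> cases d <;> simp_all [Chan.co]
    subst this
    have := h F N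
    rwa [plug_co, plug_co] at this

theorem TEquiv.refl (P : Proc X Y) : TEquiv ρ P P := fun _ _ _ => Iff.rfl

theorem TEquiv.symm {P Q : Proc X Y} (h : TEquiv ρ P Q) : TEquiv ρ Q P :=
  fun c N F => (h c N F).symm

theorem TEquiv.trans {P Q R : Proc X Y} (h : TEquiv ρ P Q) (h' : TEquiv ρ Q R) :
    TEquiv ρ P R :=
  fun c N F => (h c N F).trans (h' c N F)

/-- An input accepts only values of its declared type, so the continuations are compared on these
alone. This is what makes typed closing substitutions sufficient later. -/
theorem TEquiv.inp (c : Chan) (t : BTy Y) {P Q : Proc X Y}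
    (h : ∀ w : BVal X, w.Mem ρ t → TEquiv ρ (P.inst (.val w)) (Q.inst (.val w))) :
    TEquiv ρ (.inp c t P) (.inp c t Q) :=
  .of_chan c fun N F => by
    rw [good_inp, good_inp]
    exact exists_congr fun w => exists_congr fun N' => and_congr_right fun hw =>
      and_congr_right fun _ => h w hw c N' F

theorem TEquiv.out (c : Chan) (e : Exp X) {P Q : Proc X Y} (h : TEquiv ρ P Q) :
    TEquiv ρ (.out c e P) (.out c e Q) :=
  .of_chan c fun N F => by simp only [good_out, h c _ F]

theorem TEquiv.sel (c : Chan) (ℓ : Sel) {P Q : Proc X Y} (h : TEquiv ρ P Q) :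
    TEquiv ρ (.sel c ℓ P) (.sel c ℓ Q) :=
  .of_chan c fun N F => by simp only [good_sel, h c _ F]

theorem TEquiv.pick {P P' Q Q' : Proc X Y} (h : TEquiv ρ P P') (h' : TEquiv ρ Q Q') :
    ∀ ℓ : Sel, TEquiv ρ (ℓ.pick P Q) (ℓ.pick P' Q')
  | .inl => h
  | .inr => h'

theorem TEquiv.case (c : Chan) {P P' Q Q' : Proc X Y} (h : TEquiv ρ P P')
    (h' : TEquiv ρ Q Q') : TEquiv ρ (.case c P Q) (.case c P' Q') :=
  .of_chan c fun N F => by simp only [good_case, h.pick h' _ c _ F]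

theorem TEquiv.cond (e : Exp X) {P P' Q Q' : Proc X Y} (h : TEquiv ρ P P')
    (h' : TEquiv ρ Q Q') : TEquiv ρ (.cond e P Q) (.cond e P' Q') := fun c N F => by
  rw [good_cond, good_cond]
  refine exists_congr fun b => and_congr_right fun _ => ?_
  cases b
  exacts [h' c N F, h c N F]

theorem TEquiv.par {P P' Q Q' : Proc X Y} (h : TEquiv ρ P P')
    (h' : TEquiv ρ Q Q') : TEquiv ρ (.par P Q) (.par P' Q') :=
  .of_chan .l fun N F => by
    rw [good_par, good_par, h, plug_shift, h', plug_shift]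

/-- A terminated process cuts the list into independent halves; a second one adds only an empty,
good piece. -/
theorem TEquiv.nil_nil : TEquiv ρ (.par .nil .nil : Proc X Y) .nil :=
  .of_chan .l fun N F => by
    rw [good_par, plug, plug, good_append_nil_cons, good_append_nil_cons, good_nil_cons]

theorem TEquiv.assoc (P Q R : Proc X Y) :
    TEquiv ρ (.par P (.par Q R)) (.par (.par P Q) R) :=
  .of_chan .l fun N F => by
    rw [good_par, good_par, good_par, plug_shift, ← plug_co, Chan.co, good_par, ← plug_co,
      Chan.co, plug_shift, ← plug_shift]

theorem TEquiv.fill {P Q : Proc X Y} (h : TEquiv ρ P Q) :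
    ∀ C : RCtx X Y, TEquiv ρ (C.fill P) (C.fill Q)
  | .hole => h
  | .parL C R => (h.fill C).par (.refl R)
  | .parR R C => (TEquiv.refl R).par (h.fill C)

end Configurations

/-! ### Substitution -/

section SubstitutionLemmas

variable {X : Type u} {Y : Type v}

/-- A function on the indices with a new value at `0`. -/
def scons {A : Type*} (a : A) (f : ℕ → A) : ℕ → A
  | 0 => a
  | i + 1 => f i

theorem scons_comp_liftRen {A : Type*} (a : A) (f : ℕ → A) (g : ℕ → ℕ) :
    scons a f ∘ liftRen g = scons a (f ∘ g) := by
  funext i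
  cases i <;> rfl

theorem scons_scons_comp_swapRen {A : Type*} (a b : A) (f : ℕ → A) :
    scons a (scons b f) ∘ swapRen = scons b (scons a f) := by
  funext i
  rcases i with _ | _ | i <;> rfl

theorem liftSub_comp_liftRen (σ : ℕ → Exp X) (f : ℕ → ℕ) :
    liftSub σ ∘ liftRen f = liftSub (σ ∘ f) := by
  funext i
  cases i <;> rfl

theorem Exp.subst_rename (f : ℕ → ℕ) (σ : ℕ → Exp X) (e : Exp X) :
    (e.rename f).subst σ = e.subst (σ ∘ f) := by
  induction e with
  | var => rfl
  | val => rfl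
  | eq _ _ ih₁ ih₂ => simp only [Exp.rename, Exp.subst, ih₁, ih₂]

theorem Exp.rename_subst (σ : ℕ → Exp X) (f : ℕ → ℕ) (e : Exp X) :
    (e.subst σ).rename f = e.subst (fun i => (σ i).rename f) := by
  induction e with
  | var => rfl
  | val => rfl
  | eq _ _ ih₁ ih₂ => simp only [Exp.rename, Exp.subst, ih₁, ih₂]

theorem Exp.subst_subst (σ τ : ℕ → Exp X) (e : Exp X) :
    (e.subst σ).subst τ = e.subst (fun i => (σ i).subst τ) := by
  induction e with
  | var => rfl
  | val => rfl
  | eq _ _ ih₁ ih₂ => simp only [Exp.subst, ih₁, ih₂]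

theorem liftSub_subst_liftSub (σ τ : ℕ → Exp X) :
    (fun i => (liftSub σ i).subst (liftSub τ)) = liftSub (fun i => (σ i).subst τ) := by
  funext i
  cases i with
  | zero => rfl
  | succ i =>
    simp only [liftSub, Exp.subst_rename, Exp.rename_subst]
    rfl

theorem Proc.subst_rename (f : ℕ → ℕ) (σ : ℕ → Exp X) (P : Proc X Y) :
    (P.rename f).subst σ = P.subst (σ ∘ f) := by
  induction P generalizing f σ with
  | nil => rfl
  | inp c t P ih => simp only [Proc.rename, Proc.subst, ih, liftSub_comp_liftRen]
  | out c e P ih => simp only [Proc.rename, Proc.subst, ih, Exp.subst_rename]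
  | sel c ℓ P ih => simp only [Proc.rename, Proc.subst, ih]
  | case c P Q ih₁ ih₂ => simp only [Proc.rename, Proc.subst, ih₁, ih₂]
  | cond e P Q ih₁ ih₂ => simp only [Proc.rename, Proc.subst, ih₁, ih₂, Exp.subst_rename]
  | par P Q ih₁ ih₂ => simp only [Proc.rename, Proc.subst, ih₁, ih₂]

theorem Proc.subst_subst (σ τ : ℕ → Exp X) (P : Proc X Y) :
    (P.subst σ).subst τ = P.subst (fun i => (σ i).subst τ) := by
  induction P generalizing σ τ with
  | nil => rfl
  | inp c t P ih => simp only [Proc.subst, ih, liftSub_subst_liftSub]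
  | out c e P ih => simp only [Proc.subst, ih, Exp.subst_subst]
  | sel c ℓ P ih => simp only [Proc.subst, ih]
  | case c P Q ih₁ ih₂ => simp only [Proc.subst, ih₁, ih₂]
  | cond e P Q ih₁ ih₂ => simp only [Proc.subst, ih₁, ih₂, Exp.subst_subst]
  | par P Q ih₁ ih₂ => simp only [Proc.subst, ih₁, ih₂]

theorem Exp.subst_var (e : Exp X) : e.subst .var = e := by
  induction e with
  | var => rfl
  | val => rfl
  | eq _ _ ih₁ ih₂ => simp only [Exp.subst, ih₁, ih₂]

/-- Receiving under a substitution extends the substitution at index `0`; all the laws for inputs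
are computed in this form. -/
theorem Proc.inst_subst_liftSub (σ : ℕ → Exp X) (e : Exp X) (P : Proc X Y) :
    (P.subst (liftSub σ)).inst e = P.subst (scons e σ) := by
  rw [Proc.inst, Proc.subst_subst]
  congr 1
  funext i
  cases i with
  | zero => rfl
  | succ i =>
    simp only [liftSub, Exp.subst_rename, scons]
    exact Exp.subst_var _

theorem Proc.subst_inst (σ : ℕ → Exp X) (e : Exp X) (P : Proc X Y) :
    (P.inst e).subst σ = P.subst (scons (e.subst σ) σ) := by
  rw [Proc.inst, Proc.subst_subst]
  congr 1
  funext i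
  cases i <;> rfl

theorem Proc.subst_shift (σ : ℕ → Exp X) (e : Exp X) (P : Proc X Y) :
    P.shift.subst (scons e σ) = P.subst σ :=
  Proc.subst_rename _ _ _

theorem Proc.subst_exch (σ : ℕ → Exp X) (e e' : Exp X) (P : Proc X Y) :
    P.exch.subst (scons e (scons e' σ)) = P.subst (scons e' (scons e σ)) := by
  rw [Proc.exch, Proc.subst_rename, scons_scons_comp_swapRen]

theorem Exp.ClosedAt.subst_eq {e : Exp X} {k : ℕ} (h : e.ClosedAt k) {σ : ℕ → Exp X}
    (hσ : ∀ i < k, σ i = .var i) : e.subst σ = e := by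
  induction e with
  | var i => exact hσ i h
  | val => rfl
  | eq _ _ ih₁ ih₂ => simp only [Exp.subst, ih₁ h.1, ih₂ h.2]

theorem Proc.ClosedAt.subst_eq {P : Proc X Y} {k : ℕ} (h : P.ClosedAt k) {σ : ℕ → Exp X}
    (hσ : ∀ i < k, σ i = .var i) : P.subst σ = P := by
  induction P generalizing k σ with
  | nil => rfl
  | inp c t P ih =>
    rw [Proc.subst, ih h]
    rintro (_ | i) hi
    · rfl
    · rw [liftSub, hσ i (by omega)]
      rfl
  | out c e P ih => rw [Proc.subst, ih h.2 hσ, h.1.subst_eq hσ]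
  | sel c ℓ P ih => rw [Proc.subst, ih h hσ]
  | case c P Q ih₁ ih₂ => rw [Proc.subst, ih₁ h.1 hσ, ih₂ h.2 hσ]
  | cond e P Q ih₁ ih₂ => rw [Proc.subst, h.1.subst_eq hσ, ih₁ h.2.1 hσ, ih₂ h.2.2 hσ]
  | par P Q ih₁ ih₂ => rw [Proc.subst, ih₁ h.1 hσ, ih₂ h.2 hσ]

theorem Proc.Closed.subst_eq {P : Proc X Y} (h : P.Closed) (σ : ℕ → Exp X) :
    P.subst σ = P :=
  Proc.ClosedAt.subst_eq h (by simp)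

/-! ### Closedness is preserved by symbolic reduction -/

theorem Exp.ClosedAt.rename {e : Exp X} {k m : ℕ} (h : e.ClosedAt k) {f : ℕ → ℕ}
    (hf : ∀ i < k, f i < m) : (e.rename f).ClosedAt m := by
  induction e with
  | var i => exact hf i h
  | val => trivial
  | eq _ _ ih₁ ih₂ => exact ⟨ih₁ h.1, ih₂ h.2⟩

theorem Proc.ClosedAt.rename {P : Proc X Y} {k m : ℕ} (h : P.ClosedAt k) {f : ℕ → ℕ}
    (hf : ∀ i < k, f i < m) : (P.rename f).ClosedAt m := by
  induction P generalizing k m f with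
  | nil => trivial
  | inp c t P ih =>
    refine ih (k := k + 1) (m := m + 1) h ?_
    rintro (_ | i) hi
    · exact Nat.succ_pos m
    · exact Nat.succ_lt_succ (hf i (by omega))
  | out c e P ih => exact ⟨h.1.rename hf, ih h.2 hf⟩
  | sel c ℓ P ih => exact ih h hf
  | case c P Q ih₁ ih₂ => exact ⟨ih₁ h.1 hf, ih₂ h.2 hf⟩
  | cond e P Q ih₁ ih₂ => exact ⟨h.1.rename hf, ih₁ h.2.1 hf, ih₂ h.2.2 hf⟩
  | par P Q ih₁ ih₂ => exact ⟨ih₁ h.1 hf, ih₂ h.2 hf⟩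

theorem Exp.ClosedAt.subst {e : Exp X} {k m : ℕ} (h : e.ClosedAt k) {σ : ℕ → Exp X}
    (hσ : ∀ i < k, (σ i).ClosedAt m) : (e.subst σ).ClosedAt m := by
  induction e with
  | var i => exact hσ i h
  | val => trivial
  | eq _ _ ih₁ ih₂ => exact ⟨ih₁ h.1, ih₂ h.2⟩

theorem Proc.ClosedAt.subst {P : Proc X Y} {k m : ℕ} (h : P.ClosedAt k) {σ : ℕ → Exp X}
    (hσ : ∀ i < k, (σ i).ClosedAt m) : (P.subst σ).ClosedAt m := by
  induction P generalizing k m σ with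
  | nil => trivial
  | inp c t P ih =>
    refine ih (k := k + 1) (m := m + 1) h ?_
    rintro (_ | i) hi
    · exact Nat.succ_pos m
    · exact (hσ i (by omega)).rename fun j hj => Nat.succ_lt_succ hj
  | out c e P ih => exact ⟨h.1.subst hσ, ih h.2 hσ⟩
  | sel c ℓ P ih => exact ih h hσ
  | case c P Q ih₁ ih₂ => exact ⟨ih₁ h.1 hσ, ih₂ h.2 hσ⟩
  | cond e P Q ih₁ ih₂ => exact ⟨h.1.subst hσ, ih₁ h.2.1 hσ, ih₂ h.2.2 hσ⟩
  | par P Q ih₁ ih₂ => exact ⟨ih₁ h.1 hσ, ih₂ h.2 hσ⟩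

theorem Proc.ClosedAt.shift {P : Proc X Y} {k : ℕ} (h : P.ClosedAt k) :
    P.shift.ClosedAt (k + 1) :=
  h.rename fun _ => Nat.succ_lt_succ

theorem Proc.ClosedAt.exch {P : Proc X Y} {k : ℕ} (h : P.ClosedAt (k + 1 + 1)) :
    P.exch.ClosedAt (k + 1 + 1) :=
  h.rename fun i hi => by rcases i with _ | _ | i <;> simp only [swapRen] <;> omega

theorem Proc.ClosedAt.inst {P : Proc X Y} {k : ℕ} (h : P.ClosedAt (k + 1)) {e : Exp X}
    (he : e.ClosedAt k) : (P.inst e).ClosedAt k :=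
  h.subst fun i hi => by
    cases i with
    | zero => exact he
    | succ i => exact Nat.lt_of_succ_lt_succ hi

theorem Atom.closedAt_shift (y : Atom X) (k : ℕ) :
    y.shift.exp.ClosedAt (k + 1) ↔ y.exp.ClosedAt k := by
  cases y
  · exact Nat.succ_lt_succ_iff
  · exact Iff.rfl

theorem Swap.closedAt_iff {P Q : Proc X Y} (h : Swap P Q) (k : ℕ) :
    P.ClosedAt k ↔ Q.ClosedAt k := by
  cases h <;> simp only [Proc.ClosedAt, Atom.closedAt_shift] <;> tauto

theorem idProc_closedAt (T : SType Y) (k : ℕ) : (idProc X T).ClosedAt k := by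
  induction T generalizing k <;> simp_all [idProc, Proc.ClosedAt, Exp.ClosedAt]

theorem ECtx.closedAt_fill {P Q : Proc X Y} (h : ∀ k, P.ClosedAt k → Q.ClosedAt k)
    (E : ECtx X Y) (k : ℕ) : (E.fill P).ClosedAt k → (E.fill Q).ClosedAt k := by
  induction E generalizing k with
  | hole => exact h k
  | inp c t E ih => exact ih (k + 1)
  | out c e E ih => exact And.imp_right (ih k)
  | sel c ℓ E ih => exact ih k
  | caseL c E R ih => exact And.imp_left (ih k)
  | caseR c R E ih => exact And.imp_right (ih k)
  | condL e E R ih => exact And.imp_right (And.imp_left (ih k))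
  | condR e R E ih => exact And.imp_right (And.imp_right (ih k))

theorem SRed.closedAt {P Q : Proc X Y} (h : SRed P Q) (k : ℕ) (hP : P.ClosedAt k) :
    Q.ClosedAt k := by
  induction h generalizing k with
  | up₁ t P Q => exact ⟨hP.1, hP.2.shift⟩
  | up₂ t P Q => exact ⟨hP.1.shift, hP.2⟩
  | swap₁ c t s P => exact Proc.ClosedAt.exch hP
  | swap hs => exact (hs.closedAt_iff k).1 hP
  | swap_rev hs => exact (hs.closedAt_iff k).2 hP
  | comm₁ y t P Q => exact ⟨hP.1.2, Proc.ClosedAt.inst hP.2 hP.1.1⟩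
  | comm₂ y t P Q => exact ⟨Proc.ClosedAt.inst hP.1 hP.2.1, hP.2.2⟩
  | choice₁ ℓ P Q₁ Q₂ =>
    cases ℓ
    exacts [⟨hP.1, hP.2.1⟩, ⟨hP.1, hP.2.2⟩]
  | choice₂ ℓ P Q₁ Q₂ =>
    cases ℓ
    exacts [⟨hP.1.1, hP.2⟩, ⟨hP.1.2, hP.2⟩]
  | id T => exact hP.1
  | contexts E _ ih => exact E.closedAt_fill ih k hP
  | _ => simp only [Proc.ClosedAt] at hP ⊢; tauto

end SubstitutionLemmas

/-! ### Correctness as a property of configurations -/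

section Correctness

variable {X : Type u} {Y : Type v} {ρ : BVal X → Y → Prop}

/-- The substitution is general because the congruence goes under inputs, where the continuations
have to be compared after instantiation. -/
theorem SCong.tequiv_subst {P Q : Proc X Y} (h : SCong P Q) (σ : ℕ → Exp X) :
    TEquiv ρ (P.subst σ) (Q.subst σ) := by
  induction h generalizing σ with
  | nil_nil => exact .nil_nil
  | assoc P Q R => exact .assoc _ _ _
  | refl => exact .refl _
  | symm _ ih => exact (ih σ).symm
  | trans _ _ ih₁ ih₂ => exact (ih₁ σ).trans (ih₂ σ)
  | inp c t _ ih =>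
    refine .inp c t fun w _ => ?_
    rw [Proc.inst_subst_liftSub, Proc.inst_subst_liftSub]
    exact ih _
  | out c e _ ih => exact .out c _ (ih σ)
  | sel c ℓ _ ih => exact .sel c ℓ (ih σ)
  | case c _ _ ih₁ ih₂ => exact .case c (ih₁ σ) (ih₂ σ)
  | cond e _ _ ih₁ ih₂ => exact .cond _ (ih₁ σ) (ih₂ σ)
  | par _ _ ih₁ ih₂ => exact .par (ih₁ σ) (ih₂ σ)

theorem liftSub_var : liftSub (.var : ℕ → Exp X) = .var := by
  funext i
  cases i <;> rfl

theorem Proc.subst_var (P : Proc X Y) : P.subst .var = P := by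
  induction P with
  | nil => rfl
  | inp c t P ih => rw [Proc.subst, liftSub_var, ih]
  | out c e P ih => rw [Proc.subst, Exp.subst_var, ih]
  | sel c ℓ P ih => rw [Proc.subst, ih]
  | case c P Q ih₁ ih₂ => rw [Proc.subst, ih₁, ih₂]
  | cond e P Q ih₁ ih₂ => rw [Proc.subst, Exp.subst_var, ih₁, ih₂]
  | par P Q ih₁ ih₂ => rw [Proc.subst, ih₁, ih₂]

theorem SCong.tequiv {P Q : Proc X Y} (h : SCong P Q) : TEquiv ρ P Q := by
  simpa only [Proc.subst_var] using h.tequiv_subst .var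

/-- Communication of two adjacent processes. -/
theorem TEquiv.of_act {P Q P' Q' : Proc X Y} {α : Action X} (h : Act ρ P .r α P')
    (h' : Act ρ Q .l α.dual Q') : TEquiv ρ (.par P Q) (.par P' Q') :=
  .of_chan .l fun N F => by
    rw [good_par, good_par]
    exact (Step.append_left _ (.com F h h')).good_iff

theorem TEquiv.of_cond {e : Exp X} {b : Bool} (h : Eval e (.bool b)) (P Q : Proc X Y) :
    TEquiv ρ (.cond e P Q) (if b then P else Q) :=
  .of_chan .l fun _ F => (Step.append_left _ (.loc F (.cond h))).good_iff

/-- Confluence at work: a redex is a step of the surrounding list, and steps neither create nor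
destroy goodness. -/
theorem Red.tequiv {P Q : Proc X Y} (h : Red ρ P Q) : TEquiv ρ P Q := by
  induction h with
  | comm₁ he hw => exact .of_act (.out he) (.inp hw)
  | comm₂ he hw => exact .of_act (.inp hw) (.out he)
  | choice₁ => exact .of_act .sel .case
  | choice₂ => exact .of_act .case .sel
  | cond he => exact .of_cond he _ _
  | context C _ ih => exact ih.fill C
  | struct h₁ _ h₂ ih => exact (h₁.tequiv.trans ih).trans h₂.tequiv

theorem TEquiv.good_singleton {P Q : Proc X Y} (h : TEquiv ρ P Q) :
    Good ρ [P] ↔ Good ρ [Q] :=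
  h .l [] []

/-! ### From runs of configurations back to reduction -/

/-- The composition of a list of processes. -/
def parList : List (Proc X Y) → Proc X Y
  | [] => .nil
  | [P] => P
  | P :: Q :: L => .par P (parList (Q :: L))

theorem parList_nil {L : List (Proc X Y)} (h : ∀ P ∈ L, P = .nil) : SCong (parList L) .nil := by
  match L with
  | [] => exact .refl _
  | [P] => rw [h P (by simp)]; exact .refl _
  | P :: Q :: L =>
    rw [h P (by simp)]
    exact (SCong.par (.refl _) (parList_nil fun R hR => h R (by simp_all))).trans .nil_nil

/-- Nonemptiness matters: structural congruence has no general unit law, and an empty tail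
contributes no `0`. -/
theorem parList_cons_congr (a : Proc X Y) {L L' : List (Proc X Y)} (hL : L ≠ []) (hL' : L' ≠ [])
    (h : Red ρ (parList L) (parList L') ∨ SCong (parList L) (parList L')) :
    Red ρ (parList (a :: L)) (parList (a :: L')) ∨
      SCong (parList (a :: L)) (parList (a :: L')) := by
  match L, L', hL, hL' with
  | b :: L, b' :: L', _, _ =>
    exact h.imp (Red.context (.parR a .hole)) (SCong.par (.refl a))

theorem Act.red {a b a' b' : Proc X Y} {α : Action X} (h₁ : Act ρ a .r α a')
    (h₂ : Act ρ b .l α.dual b') : Red ρ (.par a b) (.par a' b') := by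
  cases h₁ with
  | out h => cases h₂ with | inp hw => exact .comm₁ h hw
  | inp hw => cases h₂ with | out h => exact .comm₂ h hw
  | sel => cases h₂; exact .choice₁
  | case => cases h₂; exact .choice₂

theorem Step.ne_nil {L L' : List (Proc X Y)} (h : Step ρ L L') : L ≠ [] ∧ L' ≠ [] := by
  cases h with
  | loc _ h => cases h <;> simp
  | com => simp
  | tail => simp

/-- Splitting a composition is invisible up to associativity; the other steps are genuine
reductions. -/
theorem Step.red_or_scong {L L' : List (Proc X Y)} (h : Step ρ L L') :
    Red ρ (parList L) (parList L') ∨ SCong (parList L) (parList L') := by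
  induction h with
  | loc L h =>
    cases h with
    | par P Q =>
      cases L with
      | nil => exact .inr (.refl _)
      | cons R L => exact .inr (SCong.assoc _ _ _).symm
    | cond h =>
      cases L with
      | nil => exact .inl (.cond h)
      | cons R L => exact .inl (Red.context (.parL .hole _) (.cond h))
  | com L h₁ h₂ =>
    cases L with
    | nil => exact .inl (h₁.red h₂)
    | cons R L =>
      exact .inl (.struct (.assoc _ _ _) (Red.context (.parL .hole _) (h₁.red h₂))
        (SCong.assoc _ _ _).symm)
  | tail a h ih => exact parList_cons_congr a h.ne_nil.1 h.ne_nil.2 ih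

/-- The run to termination can consist only of splittings, since its first genuine reduction would
be a reduction of `P`. -/
theorem Good.scong_nil {P : Proc X Y} (h : Good ρ [P]) (hP : ¬ ∃ Q, Red ρ P Q) :
    SCong P .nil := by
  obtain ⟨M, h, hM⟩ := h
  have hc : SCong P (parList [P]) := .refl P
  generalize [P] = L at h hc
  induction h using Relation.ReflTransGen.head_induction_on with
  | refl => exact hc.trans (parList_nil hM)
  | head hs _ ih =>
    rcases hs.red_or_scong with hr | hr
    · exact absurd ⟨_, Red.struct hc hr (.refl _)⟩ hP
    · exact ih (hc.trans hr)

/-- The number of prefixes and conditionals. -/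
def Proc.size : Proc X Y → ℕ
  | .nil => 0
  | .inp _ _ P => P.size + 1
  | .out _ _ P => P.size + 1
  | .sel _ _ P => P.size + 1
  | .case _ P Q => P.size + Q.size + 1
  | .cond _ P Q => P.size + Q.size + 1
  | .par P Q => P.size + Q.size

theorem Proc.size_subst (P : Proc X Y) (σ : ℕ → Exp X) : (P.subst σ).size = P.size := by
  induction P generalizing σ <;> simp_all [Proc.subst, Proc.size]

theorem SCong.size_eq {P Q : Proc X Y} (h : SCong P Q) : P.size = Q.size := by
  induction h <;> simp_all [Proc.size, Nat.add_assoc]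

/-- Every reduction consumes a prefix or a conditional, which gives termination. -/
theorem Red.size_lt {P Q : Proc X Y} (h : Red ρ P Q) : Q.size < P.size := by
  induction h with
  | comm₁ => simp only [Proc.size, Proc.inst, Proc.size_subst]; omega
  | comm₂ => simp only [Proc.size, Proc.inst, Proc.size_subst]; omega
  | @choice₁ ℓ => cases ℓ <;> simp only [Proc.size, Sel.pick] <;> omega
  | @choice₂ ℓ => cases ℓ <;> simp only [Proc.size, Sel.pick] <;> omega
  | @cond _ b => cases b <;> simp [Proc.size]
  | context C _ ih =>
    induction C with
    | hole => exact ih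
    | parL C R ih' => exact Nat.add_lt_add_right ih' _
    | parR R C ih' => exact Nat.add_lt_add_left ih' _
  | struct h₁ _ h₂ ih => rw [h₁.size_eq, ← h₂.size_eq]; exact ih

theorem exists_irreducible (P : Proc X Y) :
    ∃ Q, Relation.ReflTransGen (Red ρ) P Q ∧ ¬ ∃ R, Red ρ Q R := by
  induction hn : P.size using Nat.strong_induction_on generalizing P with
  | _ n ih =>
    by_cases hP : ∃ R, Red ρ P R
    · obtain ⟨R, hR⟩ := hP
      obtain ⟨Q, hQ, hn⟩ := ih R.size (hn ▸ hR.size_lt) R rfl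
      exact ⟨Q, .head hR hQ, hn⟩
    · exact ⟨P, .refl, hP⟩

theorem tequiv_of_reds {P Q : Proc X Y} (h : Relation.ReflTransGen (Red ρ) P Q) :
    TEquiv ρ P Q := by
  induction h with
  | refl => exact .refl P
  | tail _ h ih => exact ih.trans h.tequiv

/-- Reduction preserves goodness both ways and always ends, so the irreducible reducts decide: one
congruent to `0` is good, and a good one is congruent to `0`. -/
theorem correct_iff_good (P : Proc X Y) : Correct ρ P ↔ Good ρ [P] := by
  constructor
  · intro h
    obtain ⟨Q, hQ, hn⟩ := exists_irreducible (ρ := ρ) P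
    rw [(tequiv_of_reds hQ).good_singleton, (h Q hQ hn).tequiv.good_singleton]
    exact ⟨_, .refl, by simp⟩
  · intro h Q hQ hn
    exact Good.scong_nil ((tequiv_of_reds hQ).good_singleton.1 h) hn

theorem TEquiv.equiv {P Q : Proc X Y} (h : TEquiv ρ P Q) : Equiv ρ P Q := fun C => by
  rw [correct_iff_good, correct_iff_good]
  exact (h.fill C).good_singleton

end Correctness

/-! ### Typing up to inclusion of basic types -/

section TypingUpToInclusion

variable {X : Type u} {Y : Type v} (ρ : BVal X → Y → Prop)

/-- Inclusion of basic types. -/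
def BTy.Sub (s t : BTy Y) : Prop := ∀ w : BVal X, w.Mem ρ s → w.Mem ρ t

/-- Typing of expressions up to inclusion of basic types.  In contrast to `ETyped` it is
stable under the symbolic reduction of conditionals. -/
def Exp.Typed (Γ : ℕ → BTy Y) : Exp X → BTy Y → Prop
  | .var i, t => BTy.Sub ρ (Γ i) t
  | .val w, t => w.Mem ρ t
  | .eq e₁ e₂, t => BTy.Sub ρ .bool t ∧ ∃ s, e₁.Typed Γ s ∧ e₂.Typed Γ s

/-- Typing of processes over `Exp.Typed`. -/
def Proc.Typed : Proc X Y → (ℕ → BTy Y) → SType Y → SType Y → Prop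
  | .nil, _, T, S => T = .fin ∧ S = .fin
  | .inp .l t P, Γ, T, S => ∃ T', T = .inp t T' ∧ P.Typed (scons t Γ) T' S
  | .inp .r t P, Γ, T, S => ∃ S', S = .inp t S' ∧ P.Typed (scons t Γ) T S'
  | .out .l e P, Γ, T, S => ∃ t T', T = .out t T' ∧ e.Typed ρ Γ t ∧ P.Typed Γ T' S
  | .out .r e P, Γ, T, S => ∃ t S', S = .out t S' ∧ e.Typed ρ Γ t ∧ P.Typed Γ T S'
  | .sel .l ℓ P, Γ, T, S => ∃ T₁ T₂, T = .select T₁ T₂ ∧ P.Typed Γ (ℓ.pick T₁ T₂) S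
  | .sel .r ℓ P, Γ, T, S => ∃ S₁ S₂, S = .select S₁ S₂ ∧ P.Typed Γ T (ℓ.pick S₁ S₂)
  | .case .l P Q, Γ, T, S => ∃ T₁ T₂, T = .branch T₁ T₂ ∧ P.Typed Γ T₁ S ∧ Q.Typed Γ T₂ S
  | .case .r P Q, Γ, T, S => ∃ S₁ S₂, S = .branch S₁ S₂ ∧ P.Typed Γ T S₁ ∧ Q.Typed Γ T S₂
  | .cond e P Q, Γ, T, S => e.Typed ρ Γ .bool ∧ P.Typed Γ T S ∧ Q.Typed Γ T S
  | .par P Q, Γ, T, S => ∃ U : SType Y, P.Typed Γ T U ∧ Q.Typed Γ U.dual S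

variable {ρ}

theorem BTy.Sub.refl (t : BTy Y) : BTy.Sub ρ t t := fun _ => id

theorem Exp.Typed.mono {Γ : ℕ → BTy Y} {e : Exp X} {s t : BTy Y} (h : e.Typed ρ Γ s)
    (hst : BTy.Sub ρ s t) : e.Typed ρ Γ t := by
  cases e with
  | var i => exact fun w hw => hst w (h w hw)
  | val w => exact hst w h
  | eq e₁ e₂ => exact ⟨fun w hw => hst w (h.1 w hw), h.2⟩

theorem Exp.typed_rename {Γ : ℕ → BTy Y} {e : Exp X} {t : BTy Y} (f : ℕ → ℕ) :
    (e.rename f).Typed ρ Γ t ↔ e.Typed ρ (Γ ∘ f) t := by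
  induction e generalizing t with
  | var i => exact Iff.rfl
  | val w => exact Iff.rfl
  | eq e₁ e₂ ih₁ ih₂ => simp only [Exp.rename, Exp.Typed, ih₁, ih₂]

theorem Proc.typed_rename {P : Proc X Y} {Γ : ℕ → BTy Y} {T S : SType Y} (f : ℕ → ℕ) :
    (P.rename f).Typed ρ Γ T S ↔ P.Typed ρ (Γ ∘ f) T S := by
  induction P generalizing Γ T S f with
  | nil => exact Iff.rfl
  | inp c t P ih => cases c <;> simp only [Proc.rename, Proc.Typed, ih, scons_comp_liftRen]
  | out c e P ih => cases c <;> simp only [Proc.rename, Proc.Typed, ih, Exp.typed_rename]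
  | sel c ℓ P ih => cases c <;> simp only [Proc.rename, Proc.Typed, ih]
  | case c P Q ih₁ ih₂ => cases c <;> simp only [Proc.rename, Proc.Typed, ih₁, ih₂]
  | cond e P Q ih₁ ih₂ => simp only [Proc.rename, Proc.Typed, ih₁, ih₂, Exp.typed_rename]
  | par P Q ih₁ ih₂ => simp only [Proc.rename, Proc.Typed, ih₁, ih₂]

theorem Proc.typed_shift {P : Proc X Y} {Γ : ℕ → BTy Y} {t : BTy Y} {T S : SType Y} :
    P.shift.Typed ρ (scons t Γ) T S ↔ P.Typed ρ Γ T S :=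
  Proc.typed_rename _

theorem Proc.typed_exch {P : Proc X Y} {Γ : ℕ → BTy Y} {s t : BTy Y} {T S : SType Y} :
    P.exch.Typed ρ (scons t (scons s Γ)) T S ↔ P.Typed ρ (scons s (scons t Γ)) T S := by
  rw [Proc.exch, Proc.typed_rename, scons_scons_comp_swapRen]

theorem Exp.Typed.subst {Γ Δ : ℕ → BTy Y} {e : Exp X} {t : BTy Y} (h : e.Typed ρ Γ t)
    {σ : ℕ → Exp X} (hσ : ∀ i, (σ i).Typed ρ Δ (Γ i)) : (e.subst σ).Typed ρ Δ t := by
  induction e generalizing t with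
  | var i => exact (hσ i).mono h
  | val w => exact h
  | eq e₁ e₂ ih₁ ih₂ =>
    obtain ⟨h, s, h₁, h₂⟩ := h
    exact ⟨h, s, ih₁ h₁, ih₂ h₂⟩

theorem liftSub_typed {Γ Δ : ℕ → BTy Y} {σ : ℕ → Exp X} (hσ : ∀ i, (σ i).Typed ρ Δ (Γ i))
    (t : BTy Y) (i : ℕ) : (liftSub σ i).Typed ρ (scons t Δ) (scons t Γ i) := by
  cases i with
  | zero => exact BTy.Sub.refl _
  | succ i => exact (Exp.typed_rename _).2 (hσ i)

theorem Proc.Typed.subst {Γ Δ : ℕ → BTy Y} {P : Proc X Y} {T S : SType Y}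
    (h : P.Typed ρ Γ T S) {σ : ℕ → Exp X} (hσ : ∀ i, (σ i).Typed ρ Δ (Γ i)) :
    (P.subst σ).Typed ρ Δ T S := by
  induction P generalizing Γ Δ T S σ with
  | nil => exact h
  | inp c t P ih =>
    cases c <;> obtain ⟨U, rfl, h⟩ := h <;> exact ⟨U, rfl, ih h (liftSub_typed hσ t)⟩
  | out c e P ih =>
    cases c <;> obtain ⟨t, U, rfl, he, h⟩ := h <;> exact ⟨t, U, rfl, he.subst hσ, ih h hσ⟩
  | sel c ℓ P ih =>
    cases c <;> obtain ⟨U, V, rfl, h⟩ := h <;> exact ⟨U, V, rfl, ih h hσ⟩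
  | case c P Q ih₁ ih₂ =>
    cases c <;> obtain ⟨U, V, rfl, h₁, h₂⟩ := h <;> exact ⟨U, V, rfl, ih₁ h₁ hσ, ih₂ h₂ hσ⟩
  | cond e P Q ih₁ ih₂ => exact ⟨h.1.subst hσ, ih₁ h.2.1 hσ, ih₂ h.2.2 hσ⟩
  | par P Q ih₁ ih₂ =>
    obtain ⟨U, h₁, h₂⟩ := h
    exact ⟨U, ih₁ h₁ hσ, ih₂ h₂ hσ⟩

theorem Proc.Typed.inst {Γ : ℕ → BTy Y} {P : Proc X Y} {t : BTy Y} {T S : SType Y}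
    (h : P.Typed ρ (scons t Γ) T S) {e : Exp X} (he : e.Typed ρ Γ t) :
    (P.inst e).Typed ρ Γ T S :=
  h.subst fun i => by
    cases i with
    | zero => exact he
    | succ i => exact BTy.Sub.refl _

theorem ETyped.typed {L : List (BTy Y)} {e : Exp X} {t : BTy Y} (h : ETyped ρ L e t) {k : ℕ}
    (hk : e.ClosedAt k) {Γ : ℕ → BTy Y} (hΓ : ∀ i < k, ∀ t, L[i]? = some t → Γ i = t) :
    e.Typed ρ Γ t := by
  induction h with
  | var h =>
    rw [Exp.Typed, hΓ _ hk _ h]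
    exact BTy.Sub.refl _
  | val h => exact h
  | eq _ _ ih₁ ih₂ => exact ⟨BTy.Sub.refl _, _, ih₁ hk.1, ih₂ hk.2⟩

/-- Only indices below `k` are compared, so a closed process may be typed in any total environment.
-/
theorem PTyped.typed {L : List (BTy Y)} {P : Proc X Y} {T S : SType Y} (h : PTyped ρ L P T S)
    {k : ℕ} (hk : P.ClosedAt k) {Γ : ℕ → BTy Y}
    (hΓ : ∀ i < k, ∀ t, L[i]? = some t → Γ i = t) : P.Typed ρ Γ T S := by
  have hs : ∀ {L : List (BTy Y)} {k : ℕ} {Γ : ℕ → BTy Y} (s : BTy Y),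
      (∀ i < k, ∀ t, L[i]? = some t → Γ i = t) →
      ∀ i < k + 1, ∀ t, (s :: L)[i]? = some t → scons s Γ i = t := by
    rintro L k Γ s h (_ | i) hi t ht
    · simpa [scons] using ht
    · exact h i (by omega) t (by simpa using ht)
  induction h generalizing k Γ with
  | idle => exact ⟨rfl, rfl⟩
  | inp_l _ ih => exact ⟨_, rfl, ih (k := k + 1) hk (hs _ hΓ)⟩
  | inp_r _ ih => exact ⟨_, rfl, ih (k := k + 1) hk (hs _ hΓ)⟩
  | out_l he _ ih => exact ⟨_, _, rfl, he.typed hk.1 hΓ, ih hk.2 hΓ⟩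
  | out_r he _ ih => exact ⟨_, _, rfl, he.typed hk.1 hΓ, ih hk.2 hΓ⟩
  | case_l _ _ ih₁ ih₂ => exact ⟨_, _, rfl, ih₁ hk.1 hΓ, ih₂ hk.2 hΓ⟩
  | case_r _ _ ih₁ ih₂ => exact ⟨_, _, rfl, ih₁ hk.1 hΓ, ih₂ hk.2 hΓ⟩
  | inl_l _ ih => exact ⟨_, _, rfl, ih hk hΓ⟩
  | inl_r _ ih => exact ⟨_, _, rfl, ih hk hΓ⟩
  | inr_l _ ih => exact ⟨_, _, rfl, ih hk hΓ⟩
  | inr_r _ ih => exact ⟨_, _, rfl, ih hk hΓ⟩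
  | cond he _ _ ih₁ ih₂ => exact ⟨he.typed hk.1 hΓ, ih₁ hk.2.1 hΓ, ih₂ hk.2.2 hΓ⟩
  | par _ _ ih₁ ih₂ => exact ⟨_, ih₁ hk.1 hΓ, ih₂ hk.2 hΓ⟩

/-! ### Subject reduction -/

theorem Atom.typed_shift {Γ : ℕ → BTy Y} {s t : BTy Y} (y : Atom X) :
    y.shift.exp.Typed ρ (scons s Γ) t ↔ y.exp.Typed ρ Γ t := by
  cases y <;> exact Iff.rfl

theorem Swap.typed_iff {P Q : Proc X Y} (h : Swap P Q) (Γ : ℕ → BTy Y) (T S : SType Y) :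
    P.Typed ρ Γ T S ↔ Q.Typed ρ Γ T S := by
  cases h with
  | inp_out c => cases c <;> simp only [Chan.co, Proc.Typed, Atom.typed_shift] <;> aesop
  | inp_sel c => cases c <;> simp only [Chan.co, Proc.Typed] <;> aesop
  | out_sel c => cases c <;> simp only [Chan.co, Proc.Typed] <;> aesop
  | inp_case c => cases c <;> simp only [Chan.co, Proc.Typed] <;> aesop
  | out_case c => cases c <;> simp only [Chan.co, Proc.Typed] <;> aesop
  | case_sel c => cases c <;> simp only [Chan.co, Proc.Typed] <;> aesop
  | sel_sel c => cases c <;> simp only [Chan.co, Proc.Typed] <;> aesop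
  | case_case c => cases c <;> simp only [Chan.co, Proc.Typed] <;> aesop

/-- Up to inclusion `U` does not determine the types of its identity, so all three are arbitrary;
the left type comes from the first copy and the right type from the second. -/
theorem idProc_typed_comp (U : SType Y) {Γ : ℕ → BTy Y} {T T' S : SType Y}
    (h : (idProc X U).Typed ρ Γ T T') (h' : (idProc X U).Typed ρ Γ T'.dual S) :
    (idProc X U).Typed ρ Γ T S := by
  induction U generalizing Γ T T' S with
  | fin => exact ⟨h.1, h'.2⟩
  | inp t U ih =>
    obtain ⟨_, rfl, s, A, rfl, hs, h⟩ := h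
    obtain ⟨D, rfl, s', A', he, hs', h'⟩ := h'
    cases he
    exact ⟨_, rfl, _, _, rfl, hs, ih h h'⟩
  | out t U ih =>
    obtain ⟨_, rfl, s, A, rfl, hs, h⟩ := h
    obtain ⟨D, he, s', A', rfl, hs', h'⟩ := h'
    cases he
    exact ⟨_, rfl, _, _, rfl, hs', ih h h'⟩
  | branch U V ih₁ ih₂ =>
    obtain ⟨_, _, rfl, ⟨_, _, rfl, h₁⟩, ⟨_, _, he, h₂⟩⟩ := h
    cases he
    obtain ⟨_, _, rfl, ⟨_, _, he, h₁'⟩, ⟨_, _, he', h₂'⟩⟩ := h'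
    cases he
    cases he'
    exact ⟨_, _, rfl, ⟨_, _, rfl, ih₁ h₁ h₁'⟩, ⟨_, _, rfl, ih₂ h₂ h₂'⟩⟩
  | select U V ih₁ ih₂ =>
    obtain ⟨_, _, rfl, ⟨_, _, rfl, h₁⟩, ⟨_, _, he, h₂⟩⟩ := h
    cases he
    obtain ⟨_, _, he, ⟨_, _, rfl, h₁'⟩, ⟨_, _, he', h₂'⟩⟩ := h'
    cases he
    cases he'
    exact ⟨_, _, rfl, ⟨_, _, rfl, ih₁ h₁ h₁'⟩, ⟨_, _, rfl, ih₂ h₂ h₂'⟩⟩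

theorem ECtx.typed_fill {P Q : Proc X Y}
    (h : ∀ Γ T S, P.Typed ρ Γ T S → Q.Typed ρ Γ T S) (E : ECtx X Y) (Γ : ℕ → BTy Y)
    (T S : SType Y) (hE : (E.fill P).Typed ρ Γ T S) : (E.fill Q).Typed ρ Γ T S := by
  induction E generalizing Γ T S with
  | hole => exact h _ _ _ hE
  | inp c t E ih =>
    cases c <;> obtain ⟨U, rfl, hE⟩ := hE <;> exact ⟨U, rfl, ih _ _ _ hE⟩
  | out c e E ih =>
    cases c <;> obtain ⟨t, U, rfl, he, hE⟩ := hE <;> exact ⟨t, U, rfl, he, ih _ _ _ hE⟩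
  | sel c ℓ E ih =>
    cases c <;> obtain ⟨U, V, rfl, hE⟩ := hE <;> exact ⟨U, V, rfl, ih _ _ _ hE⟩
  | caseL c E R ih =>
    cases c <;> obtain ⟨U, V, rfl, hE, hR⟩ := hE <;> exact ⟨U, V, rfl, ih _ _ _ hE, hR⟩
  | caseR c R E ih =>
    cases c <;> obtain ⟨U, V, rfl, hR, hE⟩ := hE <;> exact ⟨U, V, rfl, hR, ih _ _ _ hE⟩
  | condL e E R ih => exact ⟨hE.1, ih _ _ _ hE.2.1, hE.2.2⟩
  | condR e R E ih => exact ⟨hE.1, hE.2.1, ih _ _ _ hE.2.2⟩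

/-- The reason for typing up to inclusion: the two outputs of the conditional rule may be typed at a
further type that contains both booleans, while the resulting output carries a `bool` variable. -/
theorem bool_sub {t : BTy Y} (h₁ : (BVal.bool true : BVal X).Mem ρ t)
    (h₂ : (BVal.bool false : BVal X).Mem ρ t) : BTy.Sub ρ .bool t := by
  rintro _ ⟨_ | _, rfl⟩
  exacts [h₂, h₁]

theorem SRed.typed {P Q : Proc X Y} (h : SRed P Q) (Γ : ℕ → BTy Y) (T S : SType Y)
    (hP : P.Typed ρ Γ T S) : Q.Typed ρ Γ T S := by
  induction h generalizing Γ T S with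
  | up₁ t P Q =>
    obtain ⟨U, ⟨T', rfl, h₁⟩, h₂⟩ := hP
    exact ⟨_, rfl, U, h₁, Proc.typed_shift.2 h₂⟩
  | up₂ t P Q =>
    obtain ⟨U, h₁, ⟨T', rfl, h₂⟩⟩ := hP
    exact ⟨_, rfl, U, Proc.typed_shift.2 h₁, h₂⟩
  | up₃ x P Q =>
    obtain ⟨U, ⟨t, T', rfl, he, h₁⟩, h₂⟩ := hP
    exact ⟨_, _, rfl, he, U, h₁, h₂⟩
  | up₄ x P Q =>
    obtain ⟨U, h₁, ⟨t, T', rfl, he, h₂⟩⟩ := hP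
    exact ⟨_, _, rfl, he, U, h₁, h₂⟩
  | up₅ P₁ P₂ Q =>
    obtain ⟨U, ⟨_, _, rfl, h₁, h₂⟩, h₃⟩ := hP
    exact ⟨_, _, rfl, ⟨U, h₁, h₃⟩, ⟨U, h₂, h₃⟩⟩
  | up₆ P Q₁ Q₂ =>
    obtain ⟨U, h₃, ⟨_, _, rfl, h₁, h₂⟩⟩ := hP
    exact ⟨_, _, rfl, ⟨U, h₃, h₁⟩, ⟨U, h₃, h₂⟩⟩
  | up₇ ℓ P Q =>
    obtain ⟨U, ⟨_, _, rfl, h₁⟩, h₂⟩ := hP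
    exact ⟨_, _, rfl, U, h₁, h₂⟩
  | up₈ ℓ P Q =>
    obtain ⟨U, h₁, ⟨_, _, rfl, h₂⟩⟩ := hP
    exact ⟨_, _, rfl, U, h₁, h₂⟩
  | up₉ x P₁ P₂ Q =>
    obtain ⟨U, ⟨he, h₁, h₂⟩, h₃⟩ := hP
    exact ⟨he, ⟨U, h₁, h₃⟩, ⟨U, h₂, h₃⟩⟩
  | up₁₀ x P Q₁ Q₂ =>
    obtain ⟨U, h₃, ⟨he, h₁, h₂⟩⟩ := hP
    exact ⟨he, ⟨U, h₃, h₁⟩, ⟨U, h₃, h₂⟩⟩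
  | swap₁ c t s P =>
    cases c <;> obtain ⟨_, rfl, _, rfl, h⟩ := hP <;>
      exact ⟨_, rfl, _, rfl, Proc.typed_exch.2 h⟩
  | swap₂ c x y P =>
    cases c <;> obtain ⟨_, _, rfl, h₁, _, _, rfl, h₂, h⟩ := hP <;>
      exact ⟨_, _, rfl, h₂, _, _, rfl, h₁, h⟩
  | swap hs => exact (hs.typed_iff Γ T S).1 hP
  | swap_rev hs => exact (hs.typed_iff Γ T S).2 hP
  | cond c x P =>
    cases c <;> obtain ⟨he, ⟨_, _, rfl, h₁, h⟩, ⟨_, _, he', h₂, _⟩⟩ := hP <;> cases he' <;>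
      exact ⟨_, _, rfl, he.mono (bool_sub h₁ h₂), h⟩
  | comm₁ y t P Q =>
    obtain ⟨_, ⟨_, A, rfl, he, h₁⟩, ⟨_, hA, h₂⟩⟩ := hP
    cases hA
    exact ⟨A, h₁, h₂.inst he⟩
  | comm₂ y t P Q =>
    obtain ⟨_, ⟨A, rfl, h₁⟩, ⟨_, _, hA, he, h₂⟩⟩ := hP
    cases hA
    exact ⟨A, h₁.inst he, h₂⟩
  | choice₁ ℓ P Q₁ Q₂ =>
    obtain ⟨_, ⟨A, B, rfl, h⟩, ⟨_, _, hA, h₁, h₂⟩⟩ := hP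
    cases hA
    cases ℓ
    exacts [⟨A, h, h₁⟩, ⟨B, h, h₂⟩]
  | choice₂ ℓ P₁ P₂ Q =>
    obtain ⟨_, ⟨A, B, rfl, h₁, h₂⟩, ⟨_, _, hA, h⟩⟩ := hP
    cases hA
    cases ℓ
    exacts [⟨A, h₁, h⟩, ⟨B, h₂, h⟩]
  | id U =>
    obtain ⟨T', h₁, h₂⟩ := hP
    exact idProc_typed_comp U h₁ h₂
  | contexts E _ ih => exact E.typed_fill ih Γ T S hP

/-! ### Soundness of symbolic reduction -/

/-- The substitution of values for variables. -/
def valSub (γ : ℕ → BVal X) (i : ℕ) : Exp X := .val (γ i)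

theorem scons_valSub (w : BVal X) (γ : ℕ → BVal X) :
    scons (.val w) (valSub γ) = valSub (scons w γ) := by
  funext i
  cases i <;> rfl

theorem Atom.subst_shift (σ : ℕ → Exp X) (e : Exp X) (y : Atom X) :
    y.shift.exp.subst (scons e σ) = y.exp.subst σ := by
  cases y <;> rfl

end TypingUpToInclusion

section Soundness

variable {X : Type u} {Y : Type v} {ρ : BVal X → Y → Prop}

theorem good_inp_subst (c : Chan) (t : BTy Y) (P : Proc X Y) (σ : ℕ → Exp X)
    (N F : List (Proc X Y)) :
    Good ρ (plug c N ((Proc.inp c t P).subst σ) F) ↔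
      ∃ w N', w.Mem ρ t ∧ Weak ρ c N (.send w) N' ∧
        Good ρ (plug c N' (P.subst (scons (.val w) σ)) F) := by
  simp only [Proc.subst, good_inp, Proc.inst_subst_liftSub]

theorem good_out_subst (c : Chan) (e : Exp X) (P : Proc X Y) (σ : ℕ → Exp X)
    (N F : List (Proc X Y)) :
    Good ρ (plug c N ((Proc.out c e P).subst σ) F) ↔
      ∃ w N', Eval (e.subst σ) w ∧ Weak ρ c N (.recv w) N' ∧
        Good ρ (plug c N' (P.subst σ) F) := by
  rw [Proc.subst, good_out]

theorem good_sel_subst (c : Chan) (ℓ : Sel) (P : Proc X Y) (σ : ℕ → Exp X)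
    (N F : List (Proc X Y)) :
    Good ρ (plug c N ((Proc.sel c ℓ P).subst σ) F) ↔
      ∃ N', Weak ρ c N (.offer ℓ) N' ∧ Good ρ (plug c N' (P.subst σ) F) := by
  rw [Proc.subst, good_sel]

theorem good_case_subst (c : Chan) (P Q : Proc X Y) (σ : ℕ → Exp X)
    (N F : List (Proc X Y)) :
    Good ρ (plug c N ((Proc.case c P Q).subst σ) F) ↔
      (∃ N', Weak ρ c N (.choose .inl) N' ∧ Good ρ (plug c N' (P.subst σ) F)) ∨
      ∃ N', Weak ρ c N (.choose .inr) N' ∧ Good ρ (plug c N' (Q.subst σ) F) := by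
  rw [Proc.subst, good_case]
  constructor
  · rintro ⟨_ | _, h⟩
    exacts [.inl h, .inr h]
  · rintro (h | h)
    exacts [⟨_, h⟩, ⟨_, h⟩]

theorem good_inp_subst_co (c : Chan) (t : BTy Y) (P : Proc X Y) (σ : ℕ → Exp X)
    (N F : List (Proc X Y)) :
    Good ρ (plug c N ((Proc.inp c.co t P).subst σ) F) ↔
      ∃ w F', w.Mem ρ t ∧ Weak ρ c.co F (.send w) F' ∧
        Good ρ (plug c N (P.subst (scons (.val w) σ)) F') := by
  simp only [← plug_co c N, good_inp_subst]

theorem good_out_subst_co (c : Chan) (e : Exp X) (P : Proc X Y) (σ : ℕ → Exp X)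
    (N F : List (Proc X Y)) :
    Good ρ (plug c N ((Proc.out c.co e P).subst σ) F) ↔
      ∃ w F', Eval (e.subst σ) w ∧ Weak ρ c.co F (.recv w) F' ∧
        Good ρ (plug c N (P.subst σ) F') := by
  simp only [← plug_co c N, good_out_subst]

theorem good_sel_subst_co (c : Chan) (ℓ : Sel) (P : Proc X Y) (σ : ℕ → Exp X)
    (N F : List (Proc X Y)) :
    Good ρ (plug c N ((Proc.sel c.co ℓ P).subst σ) F) ↔
      ∃ F', Weak ρ c.co F (.offer ℓ) F' ∧ Good ρ (plug c N (P.subst σ) F') := by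
  simp only [← plug_co c N, good_sel_subst]

theorem good_case_subst_co (c : Chan) (P Q : Proc X Y) (σ : ℕ → Exp X)
    (N F : List (Proc X Y)) :
    Good ρ (plug c N ((Proc.case c.co P Q).subst σ) F) ↔
      (∃ F', Weak ρ c.co F (.choose .inl) F' ∧ Good ρ (plug c N (P.subst σ) F')) ∨
      ∃ F', Weak ρ c.co F (.choose .inr) F' ∧ Good ρ (plug c N (Q.subst σ) F') := by
  simp only [← plug_co c N, good_case_subst]

/-- The composition of `P` and `Q` with `P` on the side of the channel `c`. -/
def Proc.parOn : Chan → Proc X Y → Proc X Y → Proc X Y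
  | .l, P, Q => .par P Q
  | .r, P, Q => .par Q P

theorem good_parOn (c : Chan) (P Q : Proc X Y) (N F : List (Proc X Y)) :
    Good ρ (plug c N (.parOn c P Q) F) ↔ Good ρ (plug c N P (Q :: F)) := by
  cases c
  · exact good_par P Q N F
  · rw [← plug_shift]
    exact good_par Q P F N

theorem good_parOn_co (c : Chan) (P Q : Proc X Y) (N F : List (Proc X Y)) :
    Good ρ (plug c N (.parOn c P Q) F) ↔ Good ρ (plug c (P :: N) Q F) := by
  rw [good_parOn]
  cases c <;> simp [plug]

theorem Proc.parOn_self (c : Chan) (P : Proc X Y) : Proc.parOn c P P = .par P P := by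
  cases c <;> rfl

theorem Proc.subst_parOn (c : Chan) (P Q : Proc X Y) (σ : ℕ → Exp X) :
    (Proc.parOn c P Q).subst σ = .parOn c (P.subst σ) (Q.subst σ) := by
  cases c <;> rfl

theorem TEquiv.parOn_of_act (c : Chan) {P Q P' Q' : Proc X Y} {α : Action X}
    (h : Act ρ P c.co α P') (h' : Act ρ Q c α.dual Q') :
    TEquiv ρ (.parOn c P Q) (.parOn c P' Q') := by
  cases c
  · exact .of_act h h'
  · exact .of_act h' (by rwa [Action.dual_dual])

/-- One prefix constrains only `N`, the other only `F`; once both are unfolded, the two sides differ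
by the order of quantifiers and disjunctions. -/
theorem Swap.tequiv {P Q : Proc X Y} (h : Swap P Q) (σ : ℕ → Exp X) :
    TEquiv ρ (P.subst σ) (Q.subst σ) := by
  cases h with
  | inp_out c t y P =>
    refine .of_chan c fun N F => ?_
    simp only [good_inp_subst, good_out_subst_co, Atom.subst_shift]
    grind
  | inp_sel c t ℓ P =>
    refine .of_chan c fun N F => ?_
    simp only [good_inp_subst, good_sel_subst_co]
    grind
  | out_sel c x ℓ P =>
    refine .of_chan c fun N F => ?_
    simp only [good_out_subst, good_sel_subst_co]
    grind
  | inp_case c t P Q =>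
    refine .of_chan c fun N F => ?_
    simp only [good_inp_subst, good_case_subst_co]
    grind
  | out_case c x P Q =>
    refine .of_chan c fun N F => ?_
    simp only [good_out_subst, good_case_subst_co]
    grind
  | case_sel c ℓ P Q =>
    refine .of_chan c fun N F => ?_
    simp only [good_case_subst, good_sel_subst_co]
    grind
  | sel_sel c ℓ ℓ' P =>
    refine .of_chan c fun N F => ?_
    simp only [good_sel_subst, good_sel_subst_co]
    grind
  | case_case c P₁ Q₁ P₂ Q₂ =>
    refine .of_chan c fun N F => ?_
    simp only [good_case_subst, good_case_subst_co]
    grind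

/-! ### Idempotence of identities -/

theorem idProc_subst (T : SType Y) (σ : ℕ → Exp X) : (idProc X T).subst σ = idProc X T :=
  Proc.Closed.subst_eq (idProc_closedAt T 0) σ

/-- The copy next to `c` receives a value and hands it to the other copy, which then offers the same
output as a single forwarder. What remains is the idempotence of `I`. -/
theorem tequiv_par_forward (c : Chan) (t : BTy Y) {I : Proc X Y} (hc : I.Closed)
    (hI : TEquiv ρ (.par I I) I) :
    TEquiv ρ (.par (.inp c t (.out c.co (.var 0) I)) (.inp c t (.out c.co (.var 0) I)))
      (.inp c t (.out c.co (.var 0) I)) := by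
  refine .of_chan c fun N F => ?_
  rw [← Proc.parOn_self c, good_parOn, good_inp, good_inp]
  refine exists_congr fun w => exists_congr fun N' => and_congr_right fun hw =>
    and_congr_right fun _ => ?_
  have hi : (Proc.out c.co (.var 0) I).inst (.val w) = .out c.co (.val w) I := by
    rw [Proc.inst, Proc.subst, hc.subst_eq]
    rfl
  -- The internal communication is performed, and the focus moves to the far copy to compare its
  -- output with that of the single forwarder.
  rw [← good_parOn, hi, TEquiv.parOn_of_act c (.out (.val w)) (.inp hw), hi, good_parOn_co,
    ← plug_co, ← plug_co c N', good_out, good_out]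
  refine exists_congr fun v => exists_congr fun F' => and_congr_right fun _ =>
    and_congr_right fun _ => ?_
  rw [plug_co, plug_co, ← good_parOn_co, Proc.parOn_self]
  exact hI _ _ _

theorem tequiv_par_forward_case (c : Chan) {I J : Proc X Y} (hI : TEquiv ρ (.par I I) I)
    (hJ : TEquiv ρ (.par J J) J) :
    TEquiv ρ (.par (.case c (.sel c.co .inl I) (.sel c.co .inr J))
        (.case c (.sel c.co .inl I) (.sel c.co .inr J)))
      (.case c (.sel c.co .inl I) (.sel c.co .inr J)) := by
  refine .of_chan c fun N F => ?_
  rw [← Proc.parOn_self c, good_parOn, good_case, good_case]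
  refine exists_congr fun ℓ => exists_congr fun N' => and_congr_right fun _ => ?_
  rw [← good_parOn]
  cases ℓ
  all_goals
    rw [Sel.pick, TEquiv.parOn_of_act c .sel .case, good_parOn_co, Sel.pick, ← plug_co,
      ← plug_co c N', good_sel, good_sel]
    refine exists_congr fun F' => and_congr_right fun _ => ?_
    rw [plug_co, plug_co, ← good_parOn_co, Proc.parOn_self]
  exacts [hI _ _ _, hJ _ _ _]

theorem tequiv_idProc_par (T : SType Y) :
    TEquiv ρ (.par (idProc X T) (idProc X T)) (idProc X T) := by
  induction T with
  | fin => exact .nil_nil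
  | out t T ih => exact tequiv_par_forward .l t (idProc_closedAt T 0) ih
  | inp t T ih => exact tequiv_par_forward .r t (idProc_closedAt T 0) ih
  | select T S ih₁ ih₂ => exact tequiv_par_forward_case .l ih₁ ih₂
  | branch T S ih₁ ih₂ => exact tequiv_par_forward_case .r ih₁ ih₂

/-! ### The other symbolic rules, under a substitution -/

theorem tequiv_parOn_inp (c : Chan) (t : BTy Y) (P Q : Proc X Y) (σ : ℕ → Exp X) :
    TEquiv ρ ((Proc.parOn c (.inp c t P) Q).subst σ)
      ((Proc.inp c t (.parOn c P Q.shift)).subst σ) :=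
  .of_chan c fun N F => by
    simp only [good_inp_subst, Proc.subst_parOn, good_parOn, Proc.subst_shift]

theorem tequiv_parOn_out (c : Chan) (e : Exp X) (P Q : Proc X Y) (σ : ℕ → Exp X) :
    TEquiv ρ ((Proc.parOn c (.out c e P) Q).subst σ)
      ((Proc.out c e (.parOn c P Q)).subst σ) :=
  .of_chan c fun N F => by
    simp only [good_out_subst, Proc.subst_parOn, good_parOn]

theorem tequiv_parOn_sel (c : Chan) (ℓ : Sel) (P Q : Proc X Y) (σ : ℕ → Exp X) :
    TEquiv ρ ((Proc.parOn c (.sel c ℓ P) Q).subst σ)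
      ((Proc.sel c ℓ (.parOn c P Q)).subst σ) :=
  .of_chan c fun N F => by
    simp only [good_sel_subst, Proc.subst_parOn, good_parOn]

theorem tequiv_parOn_case (c : Chan) (P₁ P₂ Q : Proc X Y) (σ : ℕ → Exp X) :
    TEquiv ρ ((Proc.parOn c (.case c P₁ P₂) Q).subst σ)
      ((Proc.case c (.parOn c P₁ Q) (.parOn c P₂ Q)).subst σ) :=
  .of_chan c fun N F => by
    simp only [good_case_subst, Proc.subst_parOn, good_parOn]

theorem tequiv_parOn_cond (c : Chan) (e : Exp X) (P₁ P₂ Q : Proc X Y) (σ : ℕ → Exp X) :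
    TEquiv ρ ((Proc.parOn c (.cond e P₁ P₂) Q).subst σ)
      ((Proc.cond e (.parOn c P₁ Q) (.parOn c P₂ Q)).subst σ) :=
  .of_chan c fun N F => by
    simp only [Proc.subst, Proc.subst_parOn, good_parOn, good_cond]
    refine exists_congr fun b => and_congr_right fun _ => ?_
    cases b
    exacts [(good_parOn c _ _ N F).symm, (good_parOn c _ _ N F).symm]

theorem tequiv_swap_inp (c : Chan) (t s : BTy Y) (P : Proc X Y) (σ : ℕ → Exp X) :
    TEquiv ρ ((Proc.inp c t (.inp c.co s P)).subst σ)
      ((Proc.inp c.co s (.inp c t P.exch)).subst σ) :=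
  .of_chan c fun N F => by
    simp only [good_inp_subst, good_inp_subst_co, Proc.subst_exch]
    grind

theorem tequiv_swap_out (c : Chan) (e e' : Exp X) (P : Proc X Y) (σ : ℕ → Exp X) :
    TEquiv ρ ((Proc.out c e (.out c.co e' P)).subst σ)
      ((Proc.out c.co e' (.out c e P)).subst σ) :=
  .of_chan c fun N F => by
    simp only [good_out_subst, good_out_subst_co]
    grind

theorem tequiv_cond_out (c : Chan) {e : Exp X} {b : Bool} {σ : ℕ → Exp X}
    (he : Eval (e.subst σ) (.bool b)) (P : Proc X Y) :
    TEquiv ρ ((Proc.cond e (.out c (.val (.bool true)) P)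
      (.out c (.val (.bool false)) P)).subst σ) ((Proc.out c e P).subst σ) := by
  refine (TEquiv.of_cond he _ _).trans (.of_chan c fun N F => ?_)
  have hv : ∀ w, Eval (e.subst σ) w ↔ Eval (.val (.bool b)) w := fun w =>
    ⟨fun h => by rw [h.det he]; exact .val _, fun h => by cases h; exact he⟩
  have hr : Good ρ (plug c N ((Proc.out c e P).subst σ) F) ↔
      Good ρ (plug c N (.out c (.val (.bool b)) (P.subst σ)) F) := by
    simp only [Proc.subst, good_out, hv]
  rw [hr]
  cases b <;> rfl

theorem tequiv_parOn_comm (c : Chan) {t : BTy Y} {e : Exp X} {w : BVal X} {σ : ℕ → Exp X}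
    (he : e.subst σ = .val w) (hw : w.Mem ρ t) (P Q : Proc X Y) :
    TEquiv ρ ((Proc.parOn c (.out c.co e P) (.inp c t Q)).subst σ)
      ((Proc.parOn c P (Q.inst e)).subst σ) := by
  rw [Proc.subst_parOn, Proc.subst_parOn, Proc.subst_inst, he, ← Proc.inst_subst_liftSub]
  exact .parOn_of_act c (.out (by rw [he]; exact .val w)) (.inp hw)

theorem tequiv_parOn_choice (c : Chan) (ℓ : Sel) (P Q₁ Q₂ : Proc X Y) (σ : ℕ → Exp X) :
    TEquiv ρ ((Proc.parOn c (.sel c.co ℓ P) (.case c Q₁ Q₂)).subst σ)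
      ((Proc.parOn c P (ℓ.pick Q₁ Q₂)).subst σ) := by
  have : (ℓ.pick Q₁ Q₂).subst σ = ℓ.pick (Q₁.subst σ) (Q₂.subst σ) := by cases ℓ <;> rfl
  rw [Proc.subst_parOn, Proc.subst_parOn, this]
  exact .parOn_of_act c .sel .case

/-- The point where typing is used: an input checks the type of what it receives and a conditional
needs a boolean, whereas the symbolic rules check neither. -/
theorem Atom.exists_value {Γ : ℕ → BTy Y} {y : Atom X} {t : BTy Y} (h : y.exp.Typed ρ Γ t)
    {γ : ℕ → BVal X} (hγ : ∀ i, (γ i).Mem ρ (Γ i)) :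
    ∃ w, y.exp.subst (valSub γ) = .val w ∧ w.Mem ρ t := by
  cases y with
  | var i => exact ⟨γ i, rfl, h _ (hγ i)⟩
  | val w => exact ⟨w, rfl, h⟩

/-- The two processes are equivalent after substitution of values of the given types. -/
def SemEquiv (ρ : BVal X → Y → Prop) (Γ : ℕ → BTy Y) (P Q : Proc X Y) : Prop :=
  ∀ γ : ℕ → BVal X, (∀ i, (γ i).Mem ρ (Γ i)) →
    TEquiv ρ (P.subst (valSub γ)) (Q.subst (valSub γ))

theorem ECtx.semEquiv_fill {P Q : Proc X Y}
    (h : ∀ Γ T S, P.Typed ρ Γ T S → SemEquiv ρ Γ P Q) (E : ECtx X Y) (Γ : ℕ → BTy Y)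
    (T S : SType Y) (hE : (E.fill P).Typed ρ Γ T S) : SemEquiv ρ Γ (E.fill P) (E.fill Q) := by
  induction E generalizing Γ T S with
  | hole => exact h _ _ _ hE
  | inp c t E ih =>
    have hE' : ∃ T' S', (E.fill P).Typed ρ (scons t Γ) T' S' := by
      cases c <;> obtain ⟨U, rfl, hE⟩ := hE <;> exact ⟨_, _, hE⟩
    obtain ⟨T', S', hE'⟩ := hE'
    refine fun γ hγ => .inp c t fun w hw => ?_
    -- The received value extends the valuation and has the type that the input adds to the
    -- environment.
    rw [Proc.inst_subst_liftSub, Proc.inst_subst_liftSub, scons_valSub]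
    refine ih _ _ _ hE' _ fun i => ?_
    cases i
    exacts [hw, hγ _]
  | out c e E ih =>
    cases c <;> obtain ⟨t, U, rfl, he, hE⟩ := hE <;>
      exact fun γ hγ => .out _ _ (ih _ _ _ hE γ hγ)
  | sel c ℓ E ih =>
    cases c <;> obtain ⟨U, V, rfl, hE⟩ := hE <;>
      exact fun γ hγ => .sel _ _ (ih _ _ _ hE γ hγ)
  | caseL c E R ih =>
    cases c <;> obtain ⟨U, V, rfl, hE, hR⟩ := hE <;>
      exact fun γ hγ => .case _ (ih _ _ _ hE γ hγ) (.refl _)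
  | caseR c R E ih =>
    cases c <;> obtain ⟨U, V, rfl, hR, hE⟩ := hE <;>
      exact fun γ hγ => .case _ (.refl _) (ih _ _ _ hE γ hγ)
  | condL e E R ih => exact fun γ hγ => .cond _ (ih _ _ _ hE.2.1 γ hγ) (.refl _)
  | condR e R E ih => exact fun γ hγ => .cond _ (.refl _) (ih _ _ _ hE.2.2 γ hγ)

theorem SRed.semEquiv {P Q : Proc X Y} (h : SRed P Q) (Γ : ℕ → BTy Y) (T S : SType Y)
    (hP : P.Typed ρ Γ T S) : SemEquiv ρ Γ P Q := by
  induction h generalizing Γ T S with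
  | up₁ t P Q => exact fun γ _ => tequiv_parOn_inp .l t P Q _
  | up₂ t P Q => exact fun γ _ => tequiv_parOn_inp .r t Q P _
  | up₃ x P Q => exact fun γ _ => tequiv_parOn_out .l _ P Q _
  | up₄ x P Q => exact fun γ _ => tequiv_parOn_out .r _ Q P _
  | up₅ P₁ P₂ Q => exact fun γ _ => tequiv_parOn_case .l P₁ P₂ Q _
  | up₆ P Q₁ Q₂ => exact fun γ _ => tequiv_parOn_case .r Q₁ Q₂ P _
  | up₇ ℓ P Q => exact fun γ _ => tequiv_parOn_sel .l ℓ P Q _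
  | up₈ ℓ P Q => exact fun γ _ => tequiv_parOn_sel .r ℓ Q P _
  | up₉ x P₁ P₂ Q => exact fun γ _ => tequiv_parOn_cond .l _ P₁ P₂ Q _
  | up₁₀ x P Q₁ Q₂ => exact fun γ _ => tequiv_parOn_cond .r _ Q₁ Q₂ P _
  | swap₁ c t s P => exact fun γ _ => tequiv_swap_inp c t s P _
  | swap₂ c x y P => exact fun γ _ => tequiv_swap_out c _ _ P _
  | swap hs => exact fun γ _ => hs.tequiv _
  | swap_rev hs => exact fun γ _ => (hs.tequiv _).symm
  | cond c x P =>
    intro γ hγ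
    obtain ⟨_, hx, b, rfl⟩ := Atom.exists_value hP.1 hγ
    exact tequiv_cond_out c (b := b) (by rw [hx]; exact .val _) P
  | comm₁ y t P Q =>
    intro γ hγ
    obtain ⟨_, ⟨_, A, rfl, he, _⟩, ⟨_, hA, _⟩⟩ := hP
    cases hA
    obtain ⟨w, hw, hm⟩ := Atom.exists_value he hγ
    exact tequiv_parOn_comm .l hw hm P Q
  | comm₂ y t P Q =>
    intro γ hγ
    obtain ⟨_, ⟨A, rfl, _⟩, ⟨_, _, hA, he, _⟩⟩ := hP
    cases hA
    obtain ⟨w, hw, hm⟩ := Atom.exists_value he hγ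
    exact tequiv_parOn_comm .r hw hm Q P
  | choice₁ ℓ P Q₁ Q₂ => exact fun γ _ => tequiv_parOn_choice .l ℓ P Q₁ Q₂ _
  | choice₂ ℓ P₁ P₂ Q => exact fun γ _ => tequiv_parOn_choice .r ℓ Q P₁ P₂ _
  | id U =>
    intro γ _
    rw [Proc.subst, idProc_subst]
    exact tequiv_idProc_par U
  | contexts E _ ih => exact E.semEquiv_fill ih Γ T S hP

/-- Closed processes are unaffected by the valuation, but one must exist; the constant environment
`unit` is inhabited by the unit value. -/
theorem SRed.tequiv {P Q : Proc X Y} (h : SRed P Q) (hP : P.Closed) {T S : SType Y}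
    (ht : P.Typed ρ (fun _ => .unit) T S) : TEquiv ρ P Q := by
  have := h.semEquiv _ _ _ ht (fun _ => .unit) fun _ => rfl
  rwa [hP.subst_eq, Proc.Closed.subst_eq (h.closedAt 0 hP)] at this

end Soundness

end Sess

theorem theorem2 {X : Type u} {Y : Type v} (ρ : Sess.BVal X → Y → Prop)
    (P Q : Sess.Proc X Y) (hclosed : P.Closed)
    (htyped : ∃ (Γ : List (Sess.BTy Y)) (T S : Sess.SType Y), Sess.PTyped ρ Γ P T S)
    (hred : Relation.ReflTransGen Sess.SRed P Q) :
    Sess.Equiv ρ P Q := by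
  obtain ⟨Γ, T, S, ht⟩ := htyped
  have ht' : P.Typed ρ (fun _ => .unit) T S := ht.typed hclosed (by simp)
  -- Closedness and typing are carried along the sequence because the soundness of each next step
  -- requires them.
  suffices h : Q.Closed ∧ Q.Typed ρ (fun _ => .unit) T S ∧ Sess.TEquiv ρ P Q from h.2.2.equiv
  induction hred with
  | refl => exact ⟨hclosed, ht', .refl P⟩
  | tail _ h ih =>
    obtain ⟨hc, hty, he⟩ := ih
    exact ⟨h.closedAt 0 hc, h.typed _ _ _ hty, he.trans (h.tequiv hc hty)⟩
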